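/- Let $m,n,k\in\mathbb{N}^+$. The data are $n$ orders $(\bm r_j,\bm A_j)$, $j=1,\dots,n$, with $\bm r_j=(r_{j1},\dots,r_{jk})\in\mathbb{R}^k$ and $\bm A_j=(\bm a_{j1},\dots,\bm a_{jk})\in\mathbb{R}^{m\times k}$, and a vector $\bm d\in\mathbb{R}^m$; put $\bm b=n\bm d$. The multi-dimensional binary program is $$\max\ \sum_{j=1}^n \bm r_j^\top\bm x_j\quad\text{s.t. }\ \sum_{j=1}^n\bm A_j\bm x_j\le \bm b,\quad \bm 1^\top\bm x_j\le 1,\quad \bm x_j\in\{0,1\}^k,\ j=1,\dots,n.$$ Let $R_n^*$ be the optimal value of its linear relaxation, in which $\bm x_j\in\{0,1\}^k$ is replaced by $\bm x_j\ge\bm 0$. The online algorithm starts from $\bm p_1=\bm 0\in\mathbb{R}^m$. At step $t=1,\dots,n$ it computes $v_t=\max_{l}\,(r_{tl}-\bm a_{tl}^\top\bm p_t)$. If $v_t>0$, it picks an index $l_t$ at random from $\{l: r_{tl}-\bm a_{tl}^\top\bm p_t=v_t\}$ (by any randomization mechanism that is independent of the data in the stochastic input model and of the arrival order in the random permutation model)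 and lets $\bm x_t$ be the $l_t$-th unit vector; otherwise $\bm x_t=\bm 0$. Then $\bm p_{t+1}=\big(\bm p_t+\tfrac1{\sqrt n}(\bm A_t\bm x_t-\bm d)\big)\vee\bm 0$, with the elementwise maximum. Write $R_n=\sum_{j}\bm r_j^\top\bm x_j$ and $v(\bm x)=\big\|\big(\sum_j\bm A_j\bm x_j-\bm b\big)^+\big\|_2$ for its objective value and its constraint violation. Let $\bar r,\bar a,\underline d,\bar d$ be constants with $\underline d>0$. Assume $\underline d\le d_i\le\bar d$ for $i=1,\dots,m$, and that all the rewards satisfy $|r_{jl}|\le\bar r$ and all the entries of the matrices $\bm A_j$ are at most $\bar a$ in absolute value. (1) Stochastic input model. Suppose that the pairs $(\bm r_j,\bm A_j)$ are i.i.d. from a distribution $\mathcal P$ under which these bounds hold almost surely. Then $R_n^*-R_n$ and $v(\bm x)$ are integrable, and $$\mathbb{E}[R_n^*-R_n]\le m(\bar a+\bar d)^2\sqrt n,\qquad \mathbb{E}[v(\bm x)]\le\Big(\frac{2\bar r+m(\bar a+\bar d)^2}{\underline d}+m(\bar a+\bar d)\Big)\sqrt n .$$ This holds for all $m,n,k\in\mathbb{N}^+$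 and all such $\mathcal P$. (2) Random permutation model. Suppose that the pairs $(\bm r_j,\bm A_j)$, $j=1,\dots,n$, are fixed and arrive in a uniformly random order, and that the data are in general position: for some optimal dual price $\bm p_n^*$, that is, a minimizer over $\bm p\ge\bm 0$ of $\bm d^\top\bm p+\frac1n\sum_{j}\big(\max_{l}(r_{jl}-\bm a_{jl}^\top\bm p)\big)^+$, and some optimal solution $\bm x^*$ of the linear relaxation, the decisions that the rule of the algorithm takes at the price $\bm p_n^*$ differ from $\bm x^*_j$ for at most $m$ values of $j$. Then $$R_n^*-\mathbb{E}[R_n]\le C\,(m+\log n)\sqrt n,\qquad \mathbb{E}[v(\bm x)]\le C\,m\sqrt n,$$ where the constant $C$ depends only on $\bar r,\bar a,\underline d,\bar d$ (not on $m$, $n$, $k$, $\bm d$ or the data). -/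

import Mathlib

open MeasureTheory ProbabilityTheory

noncomputable section

namespace MultiILP

/-- The data of one order: the rewards `z.1 l` and the resource consumptions `z.2 i l` of its
`k` options, where `i` ranges over the `m` resources. So `z.1` is the vector `r_j` and `z.2` is
the matrix `A_j`. -/
abbrev Item (m k : ℕ) : Type := (Fin k → ℝ) × (Fin m → Fin k → ℝ)

/-- All rewards are at most `rbar` and all consumptions at most `abar`, in absolute value. -/
def IsBounded {m k : ℕ} (rbar abar : ℝ) (z : Item m k) : Prop :=
  (∀ l, |z.1 l| ≤ rbar) ∧ ∀ i l, |z.2 i l| ≤ abar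

/-! ### The linear relaxation of the multi-dimensional binary program -/

/-- Objective value `∑ⱼ rⱼᵀ xⱼ`. -/
def objective {m k n : ℕ} (z : Fin n → Item m k) (x : Fin n → Fin k → ℝ) : ℝ :=
  ∑ j, ∑ l, (z j).1 l * x j l

/-- Total consumption `∑ⱼ Aⱼ xⱼ` of each resource. -/
def consumption {m k n : ℕ} (z : Fin n → Item m k) (x : Fin n → Fin k → ℝ) (i : Fin m) : ℝ :=
  ∑ j, ∑ l, (z j).2 i l * x j l

/-- Feasible points of the relaxation: `∑ⱼ Aⱼ xⱼ ≤ b = n d`, `1ᵀ xⱼ ≤ 1`, `xⱼ ≥ 0`. -/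
def feasibleSet {m k n : ℕ} (d : Fin m → ℝ) (z : Fin n → Item m k) :
    Set (Fin n → Fin k → ℝ) :=
  {x | (∀ i, consumption z x i ≤ n * d i) ∧ (∀ j, ∑ l, x j l ≤ 1) ∧ ∀ j l, 0 ≤ x j l}

/-- The optimal value `Rₙ*` of the relaxation. -/
def lpValue {m k n : ℕ} (d : Fin m → ℝ) (z : Fin n → Item m k) : ℝ :=
  sSup (objective z '' feasibleSet d z)

/-- `x` is an optimal solution of the relaxation. -/
def IsPrimalOptimal {m k n : ℕ} (d : Fin m → ℝ) (z : Fin n → Item m k)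
    (x : Fin n → Fin k → ℝ) : Prop :=
  x ∈ feasibleSet d z ∧ ∀ y ∈ feasibleSet d z, objective z y ≤ objective z x

/-! ### Dual prices -/

/-- The profit `r_{jl} - a_{jl}ᵀ p` of option `l` at price `p`. -/
def profit {m k : ℕ} (z : Item m k) (p : Fin m → ℝ) (l : Fin k) : ℝ :=
  z.1 l - ∑ i, z.2 i l * p i

/-- The largest profit among the options (a maximum over a finite set when `k > 0`). -/
def maxProfit {m k : ℕ} (z : Item m k) (p : Fin m → ℝ) : ℝ :=
  ⨆ l, profit z p l

open Classical in
/-- The set of the most profitable options. -/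
def bestOptions {m k : ℕ} (z : Item m k) (p : Fin m → ℝ) : Finset (Fin k) :=
  Finset.univ.filter fun l => profit z p l = maxProfit z p

/-- Objective of the dual problem in the price variable,
`dᵀ p + (1/n) ∑ⱼ (max_l (r_{jl} - a_{jl}ᵀ p))⁺`. -/
def dualObjective {m k n : ℕ} (d : Fin m → ℝ) (z : Fin n → Item m k) (p : Fin m → ℝ) : ℝ :=
  ∑ i, d i * p i + (1 / (n : ℝ)) * ∑ j, max (maxProfit (z j) p) 0

/-- `p` is an optimal dual price. -/
def IsDualOptimal {m k n : ℕ} (d : Fin m → ℝ) (z : Fin n → Item m k) (p : Fin m → ℝ) : Prop :=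
  0 ≤ p ∧ ∀ q : Fin m → ℝ, 0 ≤ q → dualObjective d z p ≤ dualObjective d z q

/-- `x` is a decision that the price `p` induces on one order: a most profitable option if the
largest profit is positive, and rejection otherwise. -/
def IsPriceDecision {m k : ℕ} (z : Item m k) (p : Fin m → ℝ) (x : Fin k → ℝ) : Prop :=
  (0 < maxProfit z p ∧ ∃ l ∈ bestOptions z p, x = Pi.single l 1) ∨ (maxProfit z p ≤ 0 ∧ x = 0)

/-- General position: the decisions `x(p*)` induced by an optimal dual price `p*` and an optimal
solution `x*` of the relaxation differ for at most `m` orders. -/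
def GeneralPosition {m k n : ℕ} (d : Fin m → ℝ) (z : Fin n → Item m k) : Prop :=
  ∃ (p : Fin m → ℝ) (xp xs : Fin n → Fin k → ℝ),
    IsDualOptimal d z p ∧ (∀ j, IsPriceDecision (z j) p (xp j)) ∧ IsPrimalOptimal d z xs ∧
      {j | xp j ≠ xs j}.ncard ≤ m

/-! ### The online algorithm -/

/-- A randomized way of picking an index from a nonempty set: at step `t`, with the random seed
`s`, the index picked from `A` is `pick t s A`. The law of the seed is arbitrary, so that the
uniform choice, made independently at each step, is a special case. -/
structure Picker (n k : ℕ) (S : Type*) [MeasurableSpace S] where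
  pick : Fin n → S → Finset (Fin k) → Fin k
  pick_mem : ∀ t s A, A.Nonempty → pick t s A ∈ A
  measurable_pick : ∀ t A, Measurable fun s => pick t s A

section Algorithm

variable {m k n : ℕ} {S : Type*} [MeasurableSpace S]

/-- The decision of the algorithm for the order `z` at step `t` with current price `p`. -/
def decision (τ : Picker n k S) (s : S) (t : Fin n) (z : Item m k) (p : Fin m → ℝ) : Fin k → ℝ :=
  if 0 < maxProfit z p then Pi.single (τ.pick t s (bestOptions z p)) 1 else 0

/-- The dual prices of the algorithm (steps are counted from `0`):
`p₀ = 0` and `p_{t+1} = (p_t + (A_t x_t - d) / √n) ∨ 0`. -/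
def price (τ : Picker n k S) (s : S) (d : Fin m → ℝ) (z : Fin n → Item m k) :
    ℕ → Fin m → ℝ
  | 0 => 0
  | t + 1 =>
    if h : t < n then fun i =>
      max (price τ s d z t i + 1 / √(n : ℝ) *
        (∑ l, (z ⟨t, h⟩).2 i l * decision τ s ⟨t, h⟩ (z ⟨t, h⟩) (price τ s d z t) l - d i)) 0
    else price τ s d z t

/-- The output of the algorithm when the orders arrive in the sequence `z`. -/
def output (τ : Picker n k S) (s : S) (d : Fin m → ℝ) (z : Fin n → Item m k) :
    Fin n → Fin k → ℝ :=
  fun t => decision τ s t (z t) (price τ s d z t)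

/-- The objective value `Rₙ` that the algorithm collects. -/
def reward (τ : Picker n k S) (s : S) (d : Fin m → ℝ) (z : Fin n → Item m k) : ℝ :=
  objective z (output τ s d z)

/-- The constraint violation `‖(∑ⱼ Aⱼ xⱼ - b)⁺‖₂` of the output, where `b = n d`. -/
def violation (τ : Picker n k S) (s : S) (d : Fin m → ℝ) (z : Fin n → Item m k) : ℝ :=
  ‖WithLp.toLp 2 fun i : Fin m => max (consumption z (output τ s d z) i - n * d i) 0‖

end Algorithm

/-- The discrete measurable structure on the finite set of permutations. -/
instance permMeasurableSpace (n : ℕ) : MeasurableSpace (Equiv.Perm (Fin n)) := ⊤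

end MultiILP

end

/-! The price update is projected online subgradient descent, with step `1/√n`, on the one-period
dual functions `p ↦ dᵀp + surplus z p`. Two deterministic facts hold for every data sequence and
every seed.

Regret: the decision attains the maximum in `surplus`, so the reward of a step equals its dual value
at the current price minus `pᵀ(d - A x)`. Expanding `‖p_{t+1}‖²` and telescoping bounds the sum of
these corrections by `m (abar + dbar)² √n / 2`, so the reward is at least the sum of the dual values
up to this error (`sum_dual_sub_le_reward`).

Violation: since `d ≥ dlow > 0`, large prices drift downwards, so `‖p_t‖` stays bounded uniformly in
`t` (`sum_sq_price_le`). The price accumulates the net consumption divided by `√n`, so the violation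
is at most `√n ‖p_n‖` (`violation_le`).

It remains to bound the expected dual value at step `t` from below by `Rₙ*/n`, up to a small error.
In the stochastic model `p_t` is independent of the order at step `t`, so conditionally on the past
the expected dual value is the population dual function at `p_t`, and weak duality bounds it below
by `E[Rₙ*]/n` with no error (`integral_lpValue_div_le`).

In the permutation model the next order is uniform among the `n - t` remaining ones given the past
(`sum_perm_remaining`). A feasible `x` of the full relaxation, restricted to these orders, is nearly
feasible for them: its consumption deviates from its mean by `O(√(m (n - t)))`, as for sampling
without replacement (`sum_perm_sqrt_le`). Weak duality then loses `O(m/√(n - t))` per step, and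
these losses sum to `O(m √n)` (`lpValue_sub_le_average_reward`).

All bounds are proved for a fixed seed and then integrated over the independent seed
(`integrable_and_integral_le`). -/

namespace MultiILP

/-! ### One order: surplus, loads and the decision rule -/

section Decision

variable {m k n : ℕ} {S : Type*} [MeasurableSpace S]

/-- The consumption of resource `i` by the decision `x` on the order `z`. -/
noncomputable def load (z : Item m k) (x : Fin k → ℝ) (i : Fin m) : ℝ := ∑ l, z.2 i l * x l

/-- The positive part of the largest profit. -/
noncomputable def surplus (z : Item m k) (p : Fin m → ℝ) : ℝ := max (maxProfit z p) 0

lemma surplus_nonneg (z : Item m k) (p : Fin m → ℝ) : 0 ≤ surplus z p := le_max_right _ _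

lemma profit_le_maxProfit (z : Item m k) (p : Fin m → ℝ) (l : Fin k) :
    profit z p l ≤ maxProfit z p :=
  le_ciSup (f := fun l => profit z p l) (Set.finite_range _).bddAbove l

lemma bestOptions_nonempty (hk : 0 < k) (z : Item m k) (p : Fin m → ℝ) :
    (bestOptions z p).Nonempty := by
  have : Nonempty (Fin k) := ⟨⟨0, hk⟩⟩
  obtain ⟨l, hl⟩ := exists_eq_ciSup_of_finite (f := fun l => profit z p l)
  exact ⟨l, Finset.mem_filter.2 ⟨Finset.mem_univ l, hl⟩⟩

lemma sum_profit_mul (z : Item m k) (p : Fin m → ℝ) (x : Fin k → ℝ) :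
    ∑ l, profit z p l * x l = ∑ l, z.1 l * x l - ∑ i, p i * load z x i := by
  simp only [profit, load, sub_mul, Finset.sum_sub_distrib, Finset.mul_sum, Finset.sum_mul]
  congr 1
  rw [Finset.sum_comm]
  exact Finset.sum_congr rfl fun i _ => Finset.sum_congr rfl fun l _ => by ring

/-- Weak duality for a single order: a point of the solid simplex is a subconvex combination of
options, so it cannot earn more than the best option or rejection. -/
lemma sum_profit_mul_le_surplus (z : Item m k) (p : Fin m → ℝ) {x : Fin k → ℝ}
    (hx : ∑ l, x l ≤ 1) (hx0 : ∀ l, 0 ≤ x l) : ∑ l, profit z p l * x l ≤ surplus z p :=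
  calc ∑ l, profit z p l * x l ≤ ∑ l, surplus z p * x l :=
        Finset.sum_le_sum fun l _ => mul_le_mul_of_nonneg_right
          ((profit_le_maxProfit z p l).trans (le_max_left _ _)) (hx0 l)
    _ = surplus z p * ∑ l, x l := by rw [Finset.mul_sum]
    _ ≤ surplus z p := mul_le_of_le_one_right (surplus_nonneg z p) hx

lemma abs_sum_mul_le {c : ℝ} (hc : 0 ≤ c) {u x : Fin k → ℝ} (hu : ∀ l, |u l| ≤ c)
    (hx : ∑ l, x l ≤ 1) (hx0 : ∀ l, 0 ≤ x l) : |∑ l, u l * x l| ≤ c :=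
  calc |∑ l, u l * x l| ≤ ∑ l, |u l * x l| := Finset.abs_sum_le_sum_abs _ _
    _ ≤ ∑ l, c * x l := Finset.sum_le_sum fun l _ => by
        rw [abs_mul, abs_of_nonneg (hx0 l)]
        exact mul_le_mul_of_nonneg_right (hu l) (hx0 l)
    _ = c * ∑ l, x l := by rw [Finset.mul_sum]
    _ ≤ c := mul_le_of_le_one_right hc hx

lemma decision_nonneg (τ : Picker n k S) (s : S) (t : Fin n) (z : Item m k) (p : Fin m → ℝ)
    (l : Fin k) : 0 ≤ decision τ s t z p l := by
  unfold decision
  split_ifs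
  · rw [Pi.single_apply]; split_ifs <;> norm_num
  · simp

lemma sum_decision_le (τ : Picker n k S) (s : S) (t : Fin n) (z : Item m k) (p : Fin m → ℝ) :
    ∑ l, decision τ s t z p l ≤ 1 := by
  unfold decision
  split_ifs <;> simp

/-- The decision rule is an exact maximizer, whatever the tie-breaking. This equality case of weak
duality is the only property of the picker that the regret analysis uses. -/
lemma sum_profit_mul_decision (hk : 0 < k) (τ : Picker n k S) (s : S) (t : Fin n) (z : Item m k)
    (p : Fin m → ℝ) : ∑ l, profit z p l * decision τ s t z p l = surplus z p := by
  unfold decision surplus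
  split_ifs with h
  · have hmem := τ.pick_mem t s _ (bestOptions_nonempty hk z p)
    simp only [bestOptions, Finset.mem_filter, Finset.mem_univ, true_and] at hmem
    simp only [Pi.single_apply, mul_ite, mul_one, mul_zero, Finset.sum_ite_eq', Finset.mem_univ,
      if_true]
    rw [max_eq_left h.le]
    exact hmem
  · simp [max_eq_right (not_lt.1 h)]

lemma rbar_nonneg {rbar abar : ℝ} (hk : 0 < k) {z : Item m k} (hz : IsBounded rbar abar z) :
    0 ≤ rbar := (abs_nonneg _).trans (hz.1 ⟨0, hk⟩)

lemma abar_nonneg {rbar abar : ℝ} (hm : 0 < m) (hk : 0 < k) {z : Item m k}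
    (hz : IsBounded rbar abar z) : 0 ≤ abar := (abs_nonneg _).trans (hz.2 ⟨0, hm⟩ ⟨0, hk⟩)

/-- The net consumption `A x - d` paid at the price `p` by the decision of the algorithm. -/
lemma sum_price_mul_load_decision (hk : 0 < k) (τ : Picker n k S) (s : S) (t : Fin n)
    (z : Item m k) (p : Fin m → ℝ) :
    ∑ i, p i * load z (decision τ s t z p) i =
      ∑ l, z.1 l * decision τ s t z p l - surplus z p := by
  rw [← sum_profit_mul_decision hk τ s t z p, sum_profit_mul]; ring

end Decision

/-! ### The price recursion: subgradient regret, bounded prices, constraint violation -/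

section Price

variable {m k n : ℕ} {S : Type*} [MeasurableSpace S]

lemma price_nonneg (τ : Picker n k S) (s : S) (d : Fin m → ℝ) (z : Fin n → Item m k) (t : ℕ)
    (i : Fin m) : 0 ≤ price τ s d z t i := by
  induction t with
  | zero => simp [price]
  | succ t ih =>
    rw [price]
    split_ifs
    · exact le_max_right _ _
    · exact ih

lemma price_succ (τ : Picker n k S) (s : S) (d : Fin m → ℝ) (z : Fin n → Item m k) (t : Fin n)
    (i : Fin m) : price τ s d z (t + 1) i =
      max (price τ s d z t i + 1 / √(n : ℝ) * (load (z t) (output τ s d z t) i - d i)) 0 := by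
  rw [price, dif_pos t.2]
  rfl

/-- The price at step `t` depends only on the orders before `t`. -/
lemma price_congr (τ : Picker n k S) (s : S) (d : Fin m → ℝ) {z z' : Fin n → Item m k} {t : ℕ}
    (h : ∀ j : Fin n, (j : ℕ) < t → z j = z' j) : price τ s d z t = price τ s d z' t := by
  induction t with
  | zero => rfl
  | succ t ih =>
    have ih := ih fun j hj => h j (hj.trans (Nat.lt_succ_self t))
    rw [price, price]
    split_ifs with ht
    · rw [ih, h ⟨t, ht⟩ (Nat.lt_succ_self t)]
    · exact ih

lemma abs_load_sub_le {rbar abar dlow dbar : ℝ} (hdlow : 0 < dlow) (hm : 0 < m) (hk : 0 < k)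
    {d : Fin m → ℝ} (hd : ∀ i, dlow ≤ d i ∧ d i ≤ dbar) {z : Item m k}
    (hz : IsBounded rbar abar z) (τ : Picker n k S) (s : S) (t : Fin n) (p : Fin m → ℝ)
    (i : Fin m) : |load z (decision τ s t z p) i - d i| ≤ abar + dbar := by
  have h1 : |load z (decision τ s t z p) i| ≤ abar :=
    abs_sum_mul_le (abar_nonneg hm hk hz) (hz.2 i) (sum_decision_le τ s t z p)
      (decision_nonneg τ s t z p)
  have h2 := abs_le.1 h1
  have h3 := hd i
  exact abs_le.2 ⟨by linarith, by linarith⟩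

/-- One step of the projected subgradient method. -/
lemma sum_sq_price_succ_le {rbar abar dlow dbar : ℝ} (hdlow : 0 < dlow) (hm : 0 < m)
    (hk : 0 < k) {d : Fin m → ℝ} (hd : ∀ i, dlow ≤ d i ∧ d i ≤ dbar) {z : Fin n → Item m k}
    (hz : ∀ j, IsBounded rbar abar (z j)) (τ : Picker n k S) (s : S) (t : Fin n) :
    ∑ i, price τ s d z (t + 1) i ^ 2 ≤ ∑ i, price τ s d z t i ^ 2 +
      2 / √(n : ℝ) * ∑ i, price τ s d z t i * (load (z t) (output τ s d z t) i - d i) +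
      m * (abar + dbar) ^ 2 / n := by
  have hn : (0 : ℝ) < n := by exact_mod_cast t.pos
  have key : ∀ i, price τ s d z (t + 1) i ^ 2 ≤ price τ s d z t i ^ 2 +
      2 / √(n : ℝ) * (price τ s d z t i * (load (z t) (output τ s d z t) i - d i)) +
      (abar + dbar) ^ 2 / n := by
    intro i
    have hc := abs_load_sub_le hdlow hm hk hd (hz t) τ s t (price τ s d z t) i
    change |load (z t) (output τ s d z t) i - d i| ≤ _ at hc
    rw [price_succ]
    set c := load (z t) (output τ s d z t) i - d i
    set p := price τ s d z t i
    -- Projection onto the nonnegative half-line does not increase the distance to `0`.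
    have h1 : max (p + 1 / √(n : ℝ) * c) 0 ^ 2 ≤ (p + 1 / √(n : ℝ) * c) ^ 2 := by
      rcases le_total (p + 1 / √(n : ℝ) * c) 0 with h | h
      · rw [max_eq_right h]; simpa using sq_nonneg _
      · rw [max_eq_left h]
    have h2 : c ^ 2 ≤ (abar + dbar) ^ 2 := sq_le_sq' (abs_le.1 hc).1 (abs_le.1 hc).2
    have h3 : (1 / √(n : ℝ)) ^ 2 = 1 / n := by rw [div_pow, Real.sq_sqrt hn.le, one_pow]
    have h4 : (1 / √(n : ℝ) * c) ^ 2 ≤ (abar + dbar) ^ 2 / n := by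
      rw [mul_pow, h3, one_div_mul_eq_div]
      gcongr
    calc _ ≤ _ := h1
      _ = p ^ 2 + 2 / √(n : ℝ) * (p * c) + (1 / √(n : ℝ) * c) ^ 2 := by ring
      _ ≤ _ := by linarith
  refine (Finset.sum_le_sum fun i _ => key i).trans (le_of_eq ?_)
  rw [Finset.sum_add_distrib, Finset.sum_add_distrib, ← Finset.mul_sum]
  simp [mul_div_assoc]

/-- The one-step inequality bounds each correction by a decrease of `‖p_t‖²` plus `m (abar + dbar)²
/ n`. The decreases telescope from `p_0 = 0` to `-‖p_n‖² ≤ 0`, and multiplying by `√n / 2` gives the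
bound. -/
lemma sum_price_mul_sub_load_le {rbar abar dlow dbar : ℝ} (hdlow : 0 < dlow) (hm : 0 < m)
    (hn : 0 < n) (hk : 0 < k) {d : Fin m → ℝ} (hd : ∀ i, dlow ≤ d i ∧ d i ≤ dbar)
    {z : Fin n → Item m k} (hz : ∀ j, IsBounded rbar abar (z j)) (τ : Picker n k S) (s : S) :
    ∑ t : Fin n, ∑ i, price τ s d z t i * (d i - load (z t) (output τ s d z t) i) ≤
      m * (abar + dbar) ^ 2 / 2 * √(n : ℝ) := by
  have hn' : (0 : ℝ) < n := by exact_mod_cast hn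
  have hs : 0 < √(n : ℝ) := Real.sqrt_pos.2 hn'
  have htel : ∑ t : Fin n, (∑ i, price τ s d z (t + 1) i ^ 2 - ∑ i, price τ s d z t i ^ 2)
      = ∑ i, price τ s d z n i ^ 2 := by
    rw [Fin.sum_univ_eq_sum_range
      (fun t => ∑ i, price τ s d z (t + 1) i ^ 2 - ∑ i, price τ s d z t i ^ 2) n,
      Finset.sum_range_sub (fun t => ∑ i, price τ s d z t i ^ 2)]
    simp [price]
  have hstep : ∀ t : Fin n,
      2 / √(n : ℝ) * ∑ i, price τ s d z t i * (d i - load (z t) (output τ s d z t) i) ≤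
        m * (abar + dbar) ^ 2 / n -
          (∑ i, price τ s d z (t + 1) i ^ 2 - ∑ i, price τ s d z t i ^ 2) := by
    intro t
    have h := sum_sq_price_succ_le hdlow hm hk hd hz τ s t
    have h2 : ∑ i, price τ s d z t i * (d i - load (z t) (output τ s d z t) i) =
        -∑ i, price τ s d z t i * (load (z t) (output τ s d z t) i - d i) := by
      rw [← Finset.sum_neg_distrib]
      exact Finset.sum_congr rfl fun i _ => by ring
    rw [h2]
    linarith
  have hsum := Finset.sum_le_sum fun t (_ : t ∈ Finset.univ) => hstep t
  rw [← Finset.mul_sum, Finset.sum_sub_distrib, htel] at hsum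
  have h0 : 0 ≤ ∑ i, price τ s d z n i ^ 2 := Finset.sum_nonneg fun i _ => sq_nonneg _
  have hc : ∑ _t : Fin n, (m : ℝ) * (abar + dbar) ^ 2 / n = m * (abar + dbar) ^ 2 := by
    simp; field_simp
  rw [hc] at hsum
  set X := ∑ t : Fin n, ∑ i, price τ s d z t i * (d i - load (z t) (output τ s d z t) i)
  have : X = √(n : ℝ) / 2 * (2 / √(n : ℝ) * X) := by field_simp
  rw [this]
  calc _ ≤ √(n : ℝ) / 2 * (m * (abar + dbar) ^ 2) :=
        mul_le_mul_of_nonneg_left (by linarith) (by positivity)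
    _ = _ := by ring

/-- The reward of the algorithm is at least the sum of the one-period dual values, up to the
regret of the subgradient method. -/
lemma sum_dual_sub_le_reward {rbar abar dlow dbar : ℝ} (hdlow : 0 < dlow) (hm : 0 < m)
    (hn : 0 < n) (hk : 0 < k) {d : Fin m → ℝ} (hd : ∀ i, dlow ≤ d i ∧ d i ≤ dbar)
    {z : Fin n → Item m k} (hz : ∀ j, IsBounded rbar abar (z j)) (τ : Picker n k S) (s : S) :
    ∑ t : Fin n, (∑ i, d i * price τ s d z t i + surplus (z t) (price τ s d z t)) -
      m * (abar + dbar) ^ 2 / 2 * √(n : ℝ) ≤ reward τ s d z := by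
  have h := sum_price_mul_sub_load_le hdlow hm hn hk hd hz τ s
  have h2 : ∀ t : Fin n, ∑ i, price τ s d z t i * (d i - load (z t) (output τ s d z t) i) =
      (∑ i, d i * price τ s d z t i + surplus (z t) (price τ s d z t)) -
        ∑ l, (z t).1 l * output τ s d z t l := by
    intro t
    simp only [mul_sub, Finset.sum_sub_distrib]
    rw [output, sum_price_mul_load_decision hk]
    simp only [mul_comm (price τ s d z t _)]
    ring
  simp only [h2, Finset.sum_sub_distrib] at h
  unfold reward objective
  linarith

/-- A bound on the squared Euclidean norm of the prices, uniform in the step. -/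
lemma sum_sq_price_le {rbar abar dlow dbar : ℝ} (hdlow : 0 < dlow) (hm : 0 < m)
    (hk : 0 < k) {d : Fin m → ℝ} (hd : ∀ i, dlow ≤ d i ∧ d i ≤ dbar)
    {z : Fin n → Item m k} (hz : ∀ j, IsBounded rbar abar (z j)) (τ : Picker n k S) (s : S)
    (t : ℕ) (ht : t ≤ n) : ∑ i, price τ s d z t i ^ 2 ≤
      ((2 * rbar + m * (abar + dbar) ^ 2) / dlow + m * (abar + dbar)) ^ 2 := by
  rcases Nat.eq_zero_or_pos n with hn | hn
  · obtain rfl : t = 0 := by omega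
    simp only [price, Pi.zero_apply]
    simp
    positivity
  have hr := rbar_nonneg hk (hz ⟨0, hn⟩)
  have ha := abar_nonneg hm hk (hz ⟨0, hn⟩)
  have hdb : dlow ≤ dbar := (hd ⟨0, hm⟩).1.trans (hd ⟨0, hm⟩).2
  have hm1 : (1 : ℝ) ≤ m := by exact_mod_cast hm
  have hn1 : (1 : ℝ) ≤ n := by exact_mod_cast hn
  have hs1 : 1 ≤ √(n : ℝ) := Real.one_le_sqrt.2 hn1
  -- `K` is the norm at which the upper bound for the drift of `‖p_t‖²` vanishes. Below `K` one step
  -- adds at most `2 * (dlow * K)`, because `1/√n ≤ 1`; above `K` the squared norm does not grow.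
  -- Hence `K ^ 2 + 2 * (dlow * K)` is an invariant bound.
  set K := (2 * rbar + m * (abar + dbar) ^ 2) / dlow / 2 with hK
  have hK0 : 0 ≤ K := by positivity
  have hKd : 2 * (dlow * K) = 2 * rbar + m * (abar + dbar) ^ 2 := by
    rw [hK]; field_simp
  have main : ∀ t ≤ n, ∑ i, price τ s d z t i ^ 2 ≤ K ^ 2 + 2 * (dlow * K) := by
    intro t
    induction t with
    | zero => intro _; simp only [price, Pi.zero_apply]; simp; positivity
    | succ t ih =>
      intro ht
      have ih := ih (by omega)
      have h := sum_sq_price_succ_le hdlow hm hk hd hz τ s ⟨t, ht⟩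
      simp only at h
      set Q := ∑ i, price τ s d z t i ^ 2 with hQ
      have hQ0 : 0 ≤ Q := Finset.sum_nonneg fun i _ => sq_nonneg _
      have hp := price_nonneg τ s d z t
      have hN : √Q ≤ ∑ i, price τ s d z t i := by
        refine Real.sqrt_le_iff.2 ⟨Finset.sum_nonneg fun i _ => hp i, ?_⟩
        exact Finset.sum_sq_le_sq_sum_of_nonneg fun i _ => hp i
      -- The payment `pᵀ A x` is at most the reward, since the surplus is nonnegative, while `pᵀ d ≥
      -- dlow ‖p‖₁ ≥ dlow ‖p‖₂`.
      have hc : ∑ i, price τ s d z t i *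
          (load (z ⟨t, ht⟩) (output τ s d z ⟨t, ht⟩) i - d i) ≤ rbar - dlow * √Q := by
        simp only [mul_sub, Finset.sum_sub_distrib]
        rw [output, sum_price_mul_load_decision hk]
        have h1 := (abs_le.1 (abs_sum_mul_le hr (hz ⟨t, ht⟩).1
          (sum_decision_le τ s ⟨t, ht⟩ (z ⟨t, ht⟩) (price τ s d z t))
          (decision_nonneg τ s ⟨t, ht⟩ (z ⟨t, ht⟩) (price τ s d z t)))).2
        have h2 := surplus_nonneg (z ⟨t, ht⟩) (price τ s d z t)
        have h3 : dlow * ∑ i, price τ s d z t i ≤ ∑ i, price τ s d z t i * d i := by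
          rw [Finset.mul_sum]
          refine Finset.sum_le_sum fun i _ => ?_
          rw [mul_comm]
          exact mul_le_mul_of_nonneg_left (hd i).1 (hp i)
        have h4 := mul_le_mul_of_nonneg_left hN hdlow.le
        linarith
      -- The quadratic term of the step is relaxed from order `1/n` to `1/√n`, so that it can be
      -- merged with the linear drift.
      have hG : (m : ℝ) * (abar + dbar) ^ 2 / n ≤ 1 / √(n : ℝ) * (m * (abar + dbar) ^ 2) := by
        rw [one_div_mul_eq_div]
        gcongr
        rw [Real.sqrt_le_left (by linarith)]
        nlinarith
      have hstep : ∑ i, price τ s d z (t + 1) i ^ 2 ≤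
          Q + 1 / √(n : ℝ) * (2 * (dlow * K) - 2 * (dlow * √Q)) := by
        have h5 : 2 / √(n : ℝ) * (∑ i, price τ s d z t i *
          (load (z ⟨t, ht⟩) (output τ s d z ⟨t, ht⟩) i - d i)) ≤
            2 / √(n : ℝ) * (rbar - dlow * √Q) := by gcongr
        calc _ ≤ _ := h
          _ ≤ Q + 2 / √(n : ℝ) * (rbar - dlow * √Q) +
              1 / √(n : ℝ) * (m * (abar + dbar) ^ 2) := by linarith
          _ = Q + 1 / √(n : ℝ) *
              ((2 * rbar + m * (abar + dbar) ^ 2) - 2 * (dlow * √Q)) := by ring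
          _ = _ := by rw [hKd]
      have hinv : 1 / √(n : ℝ) ≤ 1 := by rw [div_le_one (by linarith)]; exact hs1
      have hinv0 : 0 ≤ 1 / √(n : ℝ) := by positivity
      rcases le_total (√Q) K with hle | hle
      · have hQK : Q ≤ K ^ 2 := (Real.sqrt_le_left hK0).1 hle
        have h6 : 0 ≤ dlow * √Q := by positivity
        have h7 : 0 ≤ 2 * (dlow * K) - 2 * (dlow * √Q) := by
          have := mul_le_mul_of_nonneg_left hle hdlow.le
          linarith
        have h8 := mul_le_of_le_one_left h7 hinv
        linarith
      · have h7 : 2 * (dlow * K) - 2 * (dlow * √Q) ≤ 0 := by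
          have := mul_le_mul_of_nonneg_left hle hdlow.le
          linarith
        have h8 := mul_nonpos_of_nonneg_of_nonpos hinv0 h7
        linarith
  refine (main t ht).trans ?_
  have h9 : (2 * rbar + m * (abar + dbar) ^ 2) / dlow = 2 * K := by rw [hK]; ring
  rw [h9]
  -- With this the cross term of `(2 * K + m * (abar + dbar)) ^ 2` absorbs `2 * (dlow * K)`.
  have h10 : dlow ≤ m * (abar + dbar) := by nlinarith
  have h11 := mul_le_mul_of_nonneg_right h10 hK0
  nlinarith

/-- Dropping the projection only lowers the price, so each net consumption is at most `√n` times the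
price increment. Telescoping bounds the overrun of every resource by `√n` times its final price, and
the uniform norm bound applies. -/
lemma violation_le {rbar abar dlow dbar : ℝ} (hdlow : 0 < dlow) (hm : 0 < m)
    (hn : 0 < n) (hk : 0 < k) {d : Fin m → ℝ} (hd : ∀ i, dlow ≤ d i ∧ d i ≤ dbar)
    {z : Fin n → Item m k} (hz : ∀ j, IsBounded rbar abar (z j)) (τ : Picker n k S) (s : S) :
    violation τ s d z ≤
      ((2 * rbar + m * (abar + dbar) ^ 2) / dlow + m * (abar + dbar)) * √(n : ℝ) := by
  have hr := rbar_nonneg hk (hz ⟨0, hn⟩)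
  have ha := abar_nonneg hm hk (hz ⟨0, hn⟩)
  have hdb : dlow ≤ dbar := (hd ⟨0, hm⟩).1.trans (hd ⟨0, hm⟩).2
  have hdb0 : 0 ≤ abar + dbar := by linarith
  have hn' : (0 : ℝ) < n := by exact_mod_cast hn
  have hs : 0 < √(n : ℝ) := Real.sqrt_pos.2 hn'
  have hcons : ∀ i, consumption z (output τ s d z) i - n * d i ≤ √(n : ℝ) * price τ s d z n i := by
    intro i
    have hstep : ∀ t : Fin n, load (z t) (output τ s d z t) i - d i ≤
        √(n : ℝ) * (price τ s d z (t + 1) i - price τ s d z t i) := by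
      intro t
      have h : price τ s d z t i + 1 / √(n : ℝ) * (load (z t) (output τ s d z t) i - d i) ≤
          price τ s d z (t + 1) i := by
        rw [price_succ]; exact le_max_left _ _
      calc load (z t) (output τ s d z t) i - d i
          = √(n : ℝ) * (1 / √(n : ℝ) * (load (z t) (output τ s d z t) i - d i)) := by
            field_simp
        _ ≤ _ := by gcongr; linarith
    have hsum := Finset.sum_le_sum fun t (_ : t ∈ Finset.univ) => hstep t
    rw [← Finset.mul_sum, Fin.sum_univ_eq_sum_range
      (fun t => price τ s d z (t + 1) i - price τ s d z t i) n,
      Finset.sum_range_sub (fun t => price τ s d z t i), Finset.sum_sub_distrib] at hsum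
    simpa [price, consumption, load] using hsum
  unfold violation
  rw [EuclideanSpace.norm_eq]
  have hB : 0 ≤ (2 * rbar + m * (abar + dbar) ^ 2) / dlow + m * (abar + dbar) := by positivity
  refine Real.sqrt_le_iff.2 ⟨by positivity, ?_⟩
  calc ∑ i, ‖max (consumption z (output τ s d z) i - n * d i) 0‖ ^ 2
      ≤ ∑ i, (n : ℝ) * price τ s d z n i ^ 2 := by
        refine Finset.sum_le_sum fun i _ => ?_
        rw [Real.norm_eq_abs, abs_of_nonneg (le_max_right _ _)]
        calc _ ≤ (√(n : ℝ) * price τ s d z n i) ^ 2 := by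
              refine pow_le_pow_left₀ (le_max_right _ _) (max_le (hcons i) ?_) 2
              exact mul_nonneg hs.le (price_nonneg τ s d z n i)
          _ = _ := by rw [mul_pow, Real.sq_sqrt hn'.le]
    _ = n * ∑ i, price τ s d z n i ^ 2 := by rw [Finset.mul_sum]
    _ ≤ n * ((2 * rbar + m * (abar + dbar) ^ 2) / dlow + m * (abar + dbar)) ^ 2 := by
        gcongr
        exact sum_sq_price_le hdlow hm hk hd hz τ s n le_rfl
    _ = _ := by rw [mul_pow, Real.sq_sqrt hn'.le]; ring

end Price

/-! ### Weak duality for the relaxation -/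

section LinearProgram

variable {m k n : ℕ}

lemma zero_mem_feasibleSet {d : Fin m → ℝ} (hd : ∀ i, 0 ≤ d i) (z : Fin n → Item m k) :
    (0 : Fin n → Fin k → ℝ) ∈ feasibleSet d z := by
  refine ⟨fun i => ?_, fun j => ?_, fun j l => le_rfl⟩
  · simp only [consumption, Pi.zero_apply, mul_zero, Finset.sum_const_zero]
    exact mul_nonneg n.cast_nonneg (hd i)
  · simp

/-- Lagrangian bound for a feasible point, on a set of orders. -/
lemma objective_le_dual {d : Fin m → ℝ} {z : Fin n → Item m k} {x : Fin n → Fin k → ℝ}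
    (hx : x ∈ feasibleSet d z) {q : Fin m → ℝ} (hq : 0 ≤ q) :
    objective z x ≤ ∑ j, (∑ i, d i * q i + surplus (z j) q) := by
  have h1 : ∀ j, ∑ l, (z j).1 l * x j l ≤ surplus (z j) q + ∑ i, q i * load (z j) (x j) i := by
    intro j
    have := sum_profit_mul_le_surplus (z j) q (hx.2.1 j) (hx.2.2 j)
    rw [sum_profit_mul] at this
    linarith
  have h2 : ∑ j, ∑ i, q i * load (z j) (x j) i ≤ ∑ j : Fin n, ∑ i, d i * q i := by
    rw [Finset.sum_comm]
    simp only [← Finset.mul_sum, Finset.sum_const, Finset.card_univ, Fintype.card_fin,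
      nsmul_eq_mul]
    rw [Finset.mul_sum]
    refine Finset.sum_le_sum fun i _ => ?_
    have := mul_le_mul_of_nonneg_left (hx.1 i) (hq i)
    change q i * ∑ j, load (z j) (x j) i ≤ _ at this
    linarith
  have h3 := Finset.sum_le_sum fun j (_ : j ∈ Finset.univ) => h1 j
  rw [Finset.sum_add_distrib] at h3 ⊢
  unfold objective
  linarith

lemma lpValue_le_dual {d : Fin m → ℝ} (hd : ∀ i, 0 ≤ d i) (z : Fin n → Item m k)
    {q : Fin m → ℝ} (hq : 0 ≤ q) :
    lpValue d z ≤ ∑ j, (∑ i, d i * q i + surplus (z j) q) := by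
  refine csSup_le ⟨_, 0, zero_mem_feasibleSet hd z, rfl⟩ ?_
  rintro _ ⟨x, hx, rfl⟩
  exact objective_le_dual hx hq

lemma lpValue_nonneg {d : Fin m → ℝ} (hd : ∀ i, 0 ≤ d i) (z : Fin n → Item m k) :
    0 ≤ lpValue d z := by
  refine le_csSup ⟨∑ j, (∑ i, d i * 0 + surplus (z j) 0), ?_⟩
    ⟨0, zero_mem_feasibleSet hd z, by simp [objective]⟩
  rintro _ ⟨x, hx, rfl⟩
  exact objective_le_dual hx le_rfl

end LinearProgram

/-! ### Moments of sums drawn without replacement -/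

section PermutationAverages

open Equiv

variable {n : ℕ}

lemma sum_perm_mul_right (F : Perm (Fin n) → ℝ) (π : Perm (Fin n)) :
    ∑ σ, F (σ * π) = ∑ σ, F σ :=
  Equiv.sum_comp (Equiv.mulRight π) F

/-- Right multiplication by a transposition shows that every position carries the same sum; over all
positions, each permutation contributes `∑ a, f a`. -/
lemma sum_perm_apply (f : Fin n → ℝ) (j : Fin n) :
    n * ∑ σ : Perm (Fin n), f (σ j) = Fintype.card (Perm (Fin n)) * ∑ a, f a := by
  have h : ∀ i, ∑ σ : Perm (Fin n), f (σ i) = ∑ σ : Perm (Fin n), f (σ j) := by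
    intro i
    rw [← sum_perm_mul_right _ (swap i j)]
    simp [Perm.mul_apply]
  calc n * ∑ σ : Perm (Fin n), f (σ j) = ∑ i, ∑ σ : Perm (Fin n), f (σ i) := by
        simp only [h, Finset.sum_const, Finset.card_univ, Fintype.card_fin, nsmul_eq_mul]
    _ = ∑ σ : Perm (Fin n), ∑ a, f a := by
        rw [Finset.sum_comm]
        exact Finset.sum_congr rfl fun σ _ => Equiv.sum_comp σ f
    _ = _ := by simp only [Finset.sum_const, Finset.card_univ, nsmul_eq_mul]

/-- Two draws without replacement from a centered population are negatively correlated. -/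
lemma sum_perm_mul_nonpos {y : Fin n → ℝ} (hy : ∑ a, y a = 0) {i j : Fin n} (hij : i ≠ j) :
    ∑ σ : Perm (Fin n), y (σ i) * y (σ j) ≤ 0 := by
  have h : ∀ j' ∈ Finset.univ.erase i, ∑ σ : Perm (Fin n), y (σ i) * y (σ j') =
      ∑ σ : Perm (Fin n), y (σ i) * y (σ j) := by
    intro j' hj'
    rw [← sum_perm_mul_right _ (swap j' j)]
    simp [Perm.mul_apply, swap_apply_of_ne_of_ne (Finset.ne_of_mem_erase hj').symm hij]
  -- Since the population is centered, the values at the positions other than `i` sum to `-y (σ i)`,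
  -- so the total is `-∑ σ, y (σ i) ^ 2`. All the cross terms are equal, so each is nonpositive.
  have hsum : ∑ j' ∈ Finset.univ.erase i, ∑ σ : Perm (Fin n), y (σ i) * y (σ j') ≤ 0 := by
    rw [Finset.sum_comm]
    refine Finset.sum_nonpos fun σ _ => ?_
    rw [← Finset.mul_sum, Finset.sum_erase_eq_sub (Finset.mem_univ i), Equiv.sum_comp σ y, hy]
    nlinarith [sq_nonneg (y (σ i))]
  rw [Finset.sum_congr rfl h, Finset.sum_const, nsmul_eq_mul] at hsum
  have hcard : (0 : ℝ) < (Finset.univ.erase i).card := by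
    exact_mod_cast Finset.card_pos.2 ⟨j, Finset.mem_erase.2 ⟨hij.symm, Finset.mem_univ j⟩⟩
  exact nonpos_of_mul_nonpos_right hsum hcard

/-- The second moment of a sum of draws without replacement from a centered population. -/
lemma sum_perm_sum_sq_le {y : Fin n → ℝ} (hy : ∑ a, y a = 0) {c : ℝ} (hc : ∀ a, |y a| ≤ c)
    (R : Finset (Fin n)) : ∑ σ : Perm (Fin n), (∑ j ∈ R, y (σ j)) ^ 2 ≤
      Fintype.card (Perm (Fin n)) * (R.card * c ^ 2) := by
  have hrow : ∀ i ∈ R, ∑ j ∈ R, ∑ σ : Perm (Fin n), y (σ i) * y (σ j) ≤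
      Fintype.card (Perm (Fin n)) * c ^ 2 := by
    intro i hi
    calc ∑ j ∈ R, ∑ σ : Perm (Fin n), y (σ i) * y (σ j)
        ≤ ∑ j ∈ R, if i = j then (Fintype.card (Perm (Fin n)) : ℝ) * c ^ 2 else 0 := by
          refine Finset.sum_le_sum fun j _ => ?_
          split_ifs with h
          · subst h
            calc ∑ σ : Perm (Fin n), y (σ i) * y (σ i) ≤ ∑ σ : Perm (Fin n), c ^ 2 := by
                  refine Finset.sum_le_sum fun σ _ => ?_
                  rw [← sq]
                  exact sq_le_sq' (abs_le.1 (hc _)).1 (abs_le.1 (hc _)).2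
              _ = _ := by simp only [Finset.sum_const, Finset.card_univ, nsmul_eq_mul]
          · exact sum_perm_mul_nonpos hy h
      _ = _ := by rw [Finset.sum_ite_eq, if_pos hi]
  calc ∑ σ : Perm (Fin n), (∑ j ∈ R, y (σ j)) ^ 2
      = ∑ i ∈ R, ∑ j ∈ R, ∑ σ : Perm (Fin n), y (σ i) * y (σ j) := by
        simp only [sq, Finset.sum_mul_sum]
        rw [Finset.sum_comm]
        exact Finset.sum_congr rfl fun i _ => Finset.sum_comm
    _ ≤ ∑ i ∈ R, Fintype.card (Perm (Fin n)) * c ^ 2 := Finset.sum_le_sum hrow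
    _ = _ := by rw [Finset.sum_const, nsmul_eq_mul]; ring

/-- The mean Euclidean deviation of a vector-valued sum of draws without replacement. -/
lemma sum_perm_sqrt_le {m : ℕ} (hm : 0 < m) {y : Fin m → Fin n → ℝ} (hy : ∀ i, ∑ a, y i a = 0)
    {c : ℝ} (hc : ∀ i a, |y i a| ≤ c) {R : Finset (Fin n)} (hR : R.Nonempty) :
    ∑ σ : Perm (Fin n), √(∑ i, (∑ j ∈ R, y i (σ j)) ^ 2) ≤
      Fintype.card (Perm (Fin n)) * ((c ^ 2 + 1) / 2 * √(m * R.card)) := by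
  have hpos : (0 : ℝ) < m * R.card := by
    have := hR.card_pos
    positivity
  set w := √((m : ℝ) * R.card) with hw
  have hw0 : 0 < w := Real.sqrt_pos.2 hpos
  have hw2 : w ^ 2 = m * R.card := Real.sq_sqrt hpos.le
  -- AM-GM at the scale `w = √(m |R|)` linearizes the square root, so only second moments are
  -- needed. These total at most `c² w²` on average, whence the constant `(c² + 1) / 2`.
  have hamgm : ∀ q : ℝ, 0 ≤ q → √q ≤ q / (2 * w) + w / 2 := by
    intro q hq
    have h1 : √q ^ 2 = q := Real.sq_sqrt hq
    rw [div_add_div _ _ (by positivity) two_ne_zero, le_div_iff₀ (by positivity)]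
    nlinarith [sq_nonneg (√q - w)]
  calc ∑ σ : Perm (Fin n), √(∑ i, (∑ j ∈ R, y i (σ j)) ^ 2)
      ≤ ∑ σ : Perm (Fin n), ((∑ i, (∑ j ∈ R, y i (σ j)) ^ 2) / (2 * w) + w / 2) :=
        Finset.sum_le_sum fun σ _ => hamgm _ (Finset.sum_nonneg fun i _ => sq_nonneg _)
    _ = (∑ i, ∑ σ : Perm (Fin n), (∑ j ∈ R, y i (σ j)) ^ 2) / (2 * w) +
          Fintype.card (Perm (Fin n)) * (w / 2) := by
        rw [Finset.sum_add_distrib, ← Finset.sum_div, Finset.sum_comm]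
        simp only [Finset.sum_const, Finset.card_univ, nsmul_eq_mul]
    _ ≤ (∑ _i : Fin m, Fintype.card (Perm (Fin n)) * (R.card * c ^ 2)) / (2 * w) +
          Fintype.card (Perm (Fin n)) * (w / 2) := by
        gcongr with i
        exact sum_perm_sum_sq_le (hy i) (hc i) R
    _ = Fintype.card (Perm (Fin n)) * (c ^ 2 * (w ^ 2 / (2 * w)) + w / 2) := by
        rw [hw2]
        simp only [Finset.sum_const, Finset.card_univ, nsmul_eq_mul, Fintype.card_fin]
        ring
    _ = _ := by
        have : w ^ 2 / (2 * w) = w / 2 := by field_simp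
        rw [this]; ring

end PermutationAverages

/-! ### Regret in the random permutation model -/

section RandomPermutation

open Equiv

variable {m k n : ℕ} {S : Type*} [MeasurableSpace S]

/-- The consumption of resource `i` by the order `a` in the solution `x`, centered at its mean. -/
noncomputable def centeredLoad (z : Fin n → Item m k) (x : Fin n → Fin k → ℝ) (i : Fin m)
    (a : Fin n) : ℝ :=
  load (z a) (x a) i - consumption z x i / n

lemma sum_centeredLoad (hn : 0 < n) (z : Fin n → Item m k) (x : Fin n → Fin k → ℝ) (i : Fin m) :
    ∑ a, centeredLoad z x i a = 0 := by
  have : (n : ℝ) ≠ 0 := by positivity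
  simp only [centeredLoad, Finset.sum_sub_distrib, Finset.sum_const, Finset.card_univ,
    Fintype.card_fin, nsmul_eq_mul]
  rw [mul_div_cancel₀ _ this]
  exact sub_self _

lemma abs_centeredLoad_le {rbar abar : ℝ} (hn : 0 < n) (ha : 0 ≤ abar) {z : Fin n → Item m k}
    (hz : ∀ j, IsBounded rbar abar (z j)) {d : Fin m → ℝ} {x : Fin n → Fin k → ℝ}
    (hx : x ∈ feasibleSet d z) (i : Fin m) (a : Fin n) :
    |centeredLoad z x i a| ≤ 2 * abar := by
  have hn' : (0 : ℝ) < n := by exact_mod_cast hn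
  have h : ∀ a, |load (z a) (x a) i| ≤ abar := fun a =>
    abs_sum_mul_le ha ((hz a).2 i) (hx.2.1 a) (hx.2.2 a)
  have h2 : |consumption z x i / n| ≤ abar := by
    rw [abs_div, abs_of_pos hn', div_le_iff₀ hn']
    calc |∑ a, load (z a) (x a) i| ≤ ∑ a, |load (z a) (x a) i| := Finset.abs_sum_le_sum_abs _ _
      _ ≤ ∑ _a : Fin n, abar := Finset.sum_le_sum fun a _ => h a
      _ = abar * n := by simp [mul_comm]
  calc _ ≤ |load (z a) (x a) i| + |consumption z x i / n| := abs_sub _ _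
    _ ≤ _ := by linarith [h a]

/-- A lower bound, uniform in the price, for the dual function of a subset of the orders. -/
lemma sum_reward_sub_le_dual {rbar abar dlow : ℝ} (hdlow : 0 < dlow) (hr : 0 ≤ rbar) (hn : 0 < n)
    {d : Fin m → ℝ} (hd : ∀ i, dlow ≤ d i) {z : Fin n → Item m k}
    (hz : ∀ j, IsBounded rbar abar (z j)) {x : Fin n → Fin k → ℝ} (hx : x ∈ feasibleSet d z)
    {p : Fin m → ℝ} (hp : ∀ i, 0 ≤ p i) (R : Finset (Fin n)) (σ : Perm (Fin n)) :
    ∑ j ∈ R, ∑ l, (z (σ j)).1 l * x (σ j) l -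
        rbar / dlow * √(∑ i, (∑ j ∈ R, centeredLoad z x i (σ j)) ^ 2) ≤
      ∑ j ∈ R, (∑ i, d i * p i + surplus (z (σ j)) p) := by
  have hn' : (0 : ℝ) < n := by exact_mod_cast hn
  set D := √(∑ i, (∑ j ∈ R, centeredLoad z x i (σ j)) ^ 2)
  have hD : 0 ≤ D := Real.sqrt_nonneg _
  -- If `dᵀp ≥ rbar`, every dual value already exceeds any reward of one order. Otherwise `‖p‖₁ ≤
  -- rbar / dlow`, and the Lagrangian bound loses at most `‖p‖₁` times the largest deviation of the
  -- consumption from its mean, which is itself at most `d`.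
  rcases le_total rbar (∑ i, d i * p i) with h | h
  · refine le_trans (sub_le_self _ (by positivity)) (Finset.sum_le_sum fun j _ => ?_)
    have h1 := (abs_le.1 (abs_sum_mul_le hr (hz (σ j)).1 (hx.2.1 (σ j)) (hx.2.2 (σ j)))).2
    linarith [surplus_nonneg (z (σ j)) p]
  · have hp1 : ∑ i, p i ≤ rbar / dlow := by
      rw [le_div_iff₀ hdlow, Finset.sum_mul]
      refine le_trans (Finset.sum_le_sum fun i _ => ?_) h
      rw [mul_comm]
      exact mul_le_mul_of_nonneg_right (hd i) (hp i)
    have hdev : ∀ i, ∑ j ∈ R, centeredLoad z x i (σ j) ≤ D := fun i =>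
      (le_abs_self _).trans (Real.abs_le_sqrt
        (Finset.single_le_sum (f := fun i => (∑ j ∈ R, centeredLoad z x i (σ j)) ^ 2)
          (fun i _ => sq_nonneg _) (Finset.mem_univ i)))
    have hmean : ∀ i, consumption z x i / n ≤ d i := fun i => by
      rw [div_le_iff₀ hn', mul_comm]; exact hx.1 i
    have hterm : ∀ j, ∑ l, (z (σ j)).1 l * x (σ j) l - ∑ i, p i * centeredLoad z x i (σ j) ≤
        ∑ i, d i * p i + surplus (z (σ j)) p := by
      intro j
      have h1 := sum_profit_mul_le_surplus (z (σ j)) p (hx.2.1 (σ j)) (hx.2.2 (σ j))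
      rw [sum_profit_mul] at h1
      have h2 : ∑ i, p i * load (z (σ j)) (x (σ j)) i - ∑ i, d i * p i ≤
          ∑ i, p i * centeredLoad z x i (σ j) := by
        rw [← Finset.sum_sub_distrib]
        refine Finset.sum_le_sum fun i _ => ?_
        have := mul_le_mul_of_nonneg_left (hmean i) (hp i)
        simp only [centeredLoad]
        linarith
      linarith
    have hsum := Finset.sum_le_sum fun j (_ : j ∈ R) => hterm j
    rw [Finset.sum_sub_distrib] at hsum
    have hpD : ∑ j ∈ R, ∑ i, p i * centeredLoad z x i (σ j) ≤ rbar / dlow * D := by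
      rw [Finset.sum_comm]
      calc ∑ i, ∑ j ∈ R, p i * centeredLoad z x i (σ j)
          = ∑ i, p i * ∑ j ∈ R, centeredLoad z x i (σ j) := by simp only [Finset.mul_sum]
        _ ≤ ∑ i, p i * D := Finset.sum_le_sum fun i _ =>
            mul_le_mul_of_nonneg_left (hdev i) (hp i)
        _ = (∑ i, p i) * D := by rw [Finset.sum_mul]
        _ ≤ _ := mul_le_mul_of_nonneg_right hp1 hD
    linarith

/-- Conditionally on the past, the next order is uniformly distributed over the remaining ones. -/
lemma sum_perm_remaining (τ : Picker n k S) (s : S) (d : Fin m → ℝ) (z : Fin n → Item m k)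
    (t : Fin n) (G : Item m k → (Fin m → ℝ) → ℝ) :
    ∑ σ : Perm (Fin n), ∑ j ∈ Finset.Ici t,
        G (z (σ j)) (price τ s d (fun j => z (σ j)) t) =
      (Finset.Ici t).card * ∑ σ : Perm (Fin n), G (z (σ t)) (price τ s d (fun j => z (σ j)) t) := by
  rw [Finset.sum_comm, ← nsmul_eq_mul, ← Finset.sum_const]
  refine Finset.sum_congr rfl fun j hj => ?_
  -- Exchanging positions `t` and `j ≥ t` leaves all the orders before `t`, hence the price at `t`,
  -- unchanged.
  rw [← sum_perm_mul_right _ (swap t j)]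
  refine Finset.sum_congr rfl fun σ _ => ?_
  have hp : price τ s d (fun j' => z ((σ * swap t j) j')) t =
      price τ s d (fun j' => z (σ j')) t := by
    refine price_congr τ s d fun i hi => ?_
    have hit : i < t := hi
    rw [Perm.mul_apply, swap_apply_of_ne_of_ne hit.ne (hit.trans_le (Finset.mem_Ici.1 hj)).ne]
  rw [hp, Perm.mul_apply, swap_apply_right]

/-- By exchangeability the next dual value may be replaced by the mean dual value over the `n - t`
remaining orders. Their reward under `x` averages to `objective z x / n` per order, and the
deviation term of order `√(m (n - t))` is divided by `n - t`. -/
lemma card_perm_mul_le_sum_dual {rbar abar dlow dbar : ℝ} (hdlow : 0 < dlow) (hm : 0 < m)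
    (hk : 0 < k) {d : Fin m → ℝ} (hd : ∀ i, dlow ≤ d i ∧ d i ≤ dbar)
    {z : Fin n → Item m k} (hz : ∀ j, IsBounded rbar abar (z j)) {x : Fin n → Fin k → ℝ}
    (hx : x ∈ feasibleSet d z) (τ : Picker n k S) (s : S) (t : Fin n) :
    Fintype.card (Perm (Fin n)) * (objective z x / n -
        rbar / dlow * ((4 * abar ^ 2 + 1) / 2 * m) * (1 / √((n - t : ℕ) : ℝ))) ≤
      ∑ σ : Perm (Fin n), (∑ i, d i * price τ s d (fun j => z (σ j)) t i +
        surplus (z (σ t)) (price τ s d (fun j => z (σ j)) t)) := by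
  have hn : 0 < n := t.pos
  have hn' : (0 : ℝ) < n := by exact_mod_cast hn
  have hr := rbar_nonneg hk (hz ⟨0, hn⟩)
  have ha := abar_nonneg hm hk (hz ⟨0, hn⟩)
  have hcard : (Finset.Ici t).card = n - t := Fin.card_Ici t
  have hc0 : (0 : ℝ) < (Finset.Ici t).card := by
    rw [hcard]; exact_mod_cast Nat.sub_pos_of_lt t.2
  rw [← hcard]
  set c := ((Finset.Ici t).card : ℝ)
  have h1 := Finset.sum_le_sum fun σ (_ : σ ∈ (Finset.univ : Finset (Perm (Fin n)))) =>
    sum_reward_sub_le_dual hdlow hr hn (fun i => (hd i).1) hz hx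
      (fun i => price_nonneg τ s d (fun j => z (σ j)) t i) (Finset.Ici t) σ
  rw [sum_perm_remaining τ s d z t (fun z p => ∑ i, d i * p i + surplus z p),
    Finset.sum_sub_distrib, ← Finset.mul_sum] at h1
  have h2 : ∑ σ : Perm (Fin n), ∑ j ∈ Finset.Ici t, ∑ l, (z (σ j)).1 l * x (σ j) l =
      c * (Fintype.card (Perm (Fin n)) * (objective z x / n)) := by
    have h3 : ∀ j, ∑ σ : Perm (Fin n), ∑ l, (z (σ j)).1 l * x (σ j) l =
        Fintype.card (Perm (Fin n)) * (objective z x / n) := by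
      intro j
      have := sum_perm_apply (fun a => ∑ l, (z a).1 l * x a l) j
      change _ = _ * objective z x at this
      rw [← mul_div_assoc, eq_div_iff hn'.ne', mul_comm, this]
    rw [Finset.sum_comm]
    simp only [h3, Finset.sum_const, nsmul_eq_mul]
    rfl
  have h4 := sum_perm_sqrt_le hm (fun i => sum_centeredLoad hn z x i)
    (fun i a => abs_centeredLoad_le hn ha hz hx i a) (R := Finset.Ici t) ⟨t, by simp⟩
  -- Here `√m` is relaxed to `m`, which the final rate allows.
  have h5 : √((m : ℝ) * c) ≤ c * (m * (1 / √c)) := by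
    have hm1 : (1 : ℝ) ≤ m := by exact_mod_cast hm
    rw [Real.sqrt_mul (by positivity)]
    have h6 : √(m : ℝ) ≤ m := Real.sqrt_le_left (by positivity) |>.2 (by nlinarith)
    have h7 : c * (m * (1 / √c)) = m * √c := by
      have hs : 0 < √c := Real.sqrt_pos.2 hc0
      have : c = √c * √c := (Real.mul_self_sqrt hc0.le).symm
      nth_rewrite 1 [this]
      field_simp
    rw [h7]
    gcongr
  rw [h2] at h1
  have h8 : rbar / dlow * ∑ σ : Perm (Fin n),
      √(∑ i, (∑ j ∈ Finset.Ici t, centeredLoad z x i (σ j)) ^ 2) ≤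
      c * (Fintype.card (Perm (Fin n)) *
        (rbar / dlow * ((4 * abar ^ 2 + 1) / 2 * m) * (1 / √c))) := by
    calc _ ≤ rbar / dlow * (Fintype.card (Perm (Fin n)) *
          (((2 * abar) ^ 2 + 1) / 2 * (c * (m * (1 / √c))))) := by
          refine mul_le_mul_of_nonneg_left (h4.trans ?_) (by positivity)
          gcongr
      _ = _ := by ring
  refine le_of_mul_le_mul_left ?_ hc0
  refine le_trans (le_of_eq ?_) ((sub_le_sub_left h8 _).trans h1)
  ring

lemma sum_one_div_sqrt_le (n : ℕ) : ∑ i ∈ Finset.range n, 1 / √((i + 1 : ℕ) : ℝ) ≤ 2 * √(n : ℝ) := by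
  induction n with
  | zero => simp
  | succ n ih =>
    rw [Finset.sum_range_succ]
    have hpos : 0 < √((n + 1 : ℕ) : ℝ) := Real.sqrt_pos.2 (by positivity)
    have h1 : √((n + 1 : ℕ) : ℝ) ^ 2 = n + 1 := by
      rw [Real.sq_sqrt (by positivity)]; push_cast; ring
    have h2 : √(n : ℝ) ^ 2 = n := Real.sq_sqrt (by positivity)
    -- Each term is dominated by an increment of `2√x`, by concavity.
    have h3 : 1 / √((n + 1 : ℕ) : ℝ) ≤ 2 * √((n + 1 : ℕ) : ℝ) - 2 * √(n : ℝ) := by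
      rw [div_le_iff₀ hpos]
      nlinarith [sq_nonneg (√((n + 1 : ℕ) : ℝ) - √(n : ℝ))]
    linarith

lemma sum_fin_one_div_sqrt_le (n : ℕ) :
    ∑ t : Fin n, 1 / √((n - t : ℕ) : ℝ) ≤ 2 * √(n : ℝ) := by
  rw [Fin.sum_univ_eq_sum_range (fun t => 1 / √((n - t : ℕ) : ℝ)) n, ← Finset.sum_range_reflect]
  refine le_trans (le_of_eq (Finset.sum_congr rfl fun i hi => ?_)) (sum_one_div_sqrt_le n)
  have : n - (n - 1 - i) = i + 1 := by have := Finset.mem_range.1 hi; omega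
  rw [this]

/-- The regret bound in the random permutation model, for a fixed seed. -/
lemma lpValue_sub_le_average_reward {rbar abar dlow dbar : ℝ} (hdlow : 0 < dlow) (hm : 0 < m)
    (hn : 0 < n) (hk : 0 < k) {d : Fin m → ℝ} (hd : ∀ i, dlow ≤ d i ∧ d i ≤ dbar)
    {z : Fin n → Item m k} (hz : ∀ j, IsBounded rbar abar (z j)) (τ : Picker n k S) (s : S) :
    Fintype.card (Perm (Fin n)) * (lpValue d z -
        (rbar / dlow * (4 * abar ^ 2 + 1) + (abar + dbar) ^ 2 / 2) * (m * √(n : ℝ))) ≤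
      ∑ σ : Perm (Fin n), reward τ s d (fun j => z (σ j)) := by
  have hN : (0 : ℝ) < Fintype.card (Perm (Fin n)) := by exact_mod_cast Fintype.card_pos
  have hn' : (n : ℝ) ≠ 0 := by positivity
  have hr := rbar_nonneg hk (hz ⟨0, hn⟩)
  set N := (Fintype.card (Perm (Fin n)) : ℝ)
  set B := (rbar / dlow * (4 * abar ^ 2 + 1) + (abar + dbar) ^ 2 / 2) * (m * √(n : ℝ))
  -- The value is isolated as a supremum, so that it suffices to treat an arbitrary feasible `x`; no
  -- optimal solution has to be chosen.
  rw [← le_div_iff₀' hN, sub_le_iff_le_add]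
  refine csSup_le ⟨_, 0, zero_mem_feasibleSet (fun i => hdlow.le.trans (hd i).1) z, rfl⟩ ?_
  rintro _ ⟨x, hx, rfl⟩
  rw [← sub_le_iff_le_add, le_div_iff₀' hN]
  have h1 := Finset.sum_le_sum fun t (_ : t ∈ (Finset.univ : Finset (Fin n))) =>
    card_perm_mul_le_sum_dual hdlow hm hk hd hz hx τ s t
  have h2 := Finset.sum_le_sum fun σ (_ : σ ∈ (Finset.univ : Finset (Perm (Fin n)))) =>
    sum_dual_sub_le_reward hdlow hm hn hk hd (fun j => hz (σ j)) τ s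
  rw [Finset.sum_sub_distrib, Finset.sum_comm] at h2
  rw [← Finset.mul_sum, Finset.sum_sub_distrib, ← Finset.mul_sum] at h1
  simp only [Finset.sum_const, Finset.card_univ, Fintype.card_fin, nsmul_eq_mul] at h1 h2
  rw [mul_div_cancel₀ _ hn'] at h1
  have h3 : rbar / dlow * ((4 * abar ^ 2 + 1) / 2 * m) * ∑ t : Fin n, 1 / √((n - t : ℕ) : ℝ) ≤
      rbar / dlow * ((4 * abar ^ 2 + 1) / 2 * m) * (2 * √(n : ℝ)) :=
    mul_le_mul_of_nonneg_left (sum_fin_one_div_sqrt_le n) (by positivity)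
  have h4 := mul_le_mul_of_nonneg_left (sub_le_sub_left h3 (objective z x)) hN.le
  calc N * (objective z x - B)
      = N * (objective z x - rbar / dlow * ((4 * abar ^ 2 + 1) / 2 * m) * (2 * √(n : ℝ))) -
        N * (m * (abar + dbar) ^ 2 / 2 * √(n : ℝ)) := by simp only [B]; ring
    _ ≤ _ := by linarith

end RandomPermutation

/-! ### Measurability of the algorithm and of the optimal value -/

section Measurability

variable {m k n : ℕ} {S : Type*} [MeasurableSpace S]

lemma measurable_profit (l : Fin k) :
    Measurable fun w : Item m k × (Fin m → ℝ) => profit w.1 w.2 l := by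
  unfold profit
  fun_prop

lemma measurable_maxProfit :
    Measurable fun w : Item m k × (Fin m → ℝ) => maxProfit w.1 w.2 :=
  Measurable.iSup measurable_profit

lemma measurable_surplus :
    Measurable fun w : Item m k × (Fin m → ℝ) => surplus w.1 w.2 :=
  measurable_maxProfit.max measurable_const

lemma measurableSet_bestOptions_eq (A : Finset (Fin k)) :
    MeasurableSet {w : Item m k × (Fin m → ℝ) | bestOptions w.1 w.2 = A} := by
  have : {w : Item m k × (Fin m → ℝ) | bestOptions w.1 w.2 = A} =
      ⋂ l, {w | profit w.1 w.2 l = maxProfit w.1 w.2 ↔ l ∈ A} := by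
    ext w
    simp [Finset.ext_iff, bestOptions]
  rw [this]
  refine MeasurableSet.iInter fun l => ?_
  have hl := measurableSet_eq_fun (measurable_profit (m := m) l) measurable_maxProfit
  by_cases h : l ∈ A
  · simpa [h] using hl
  · simp only [h, iff_false]
    exact hl.compl

/-- The pick is measurable in the seed only for a fixed set of options, so the event is split along
the finitely many values of `bestOptions`. -/
lemma measurable_decision (τ : Picker n k S) (t : Fin n) (l : Fin k) :
    Measurable fun w : (Item m k × (Fin m → ℝ)) × S => decision τ w.2 t w.1.1 w.1.2 l := by
  have hset : MeasurableSet {w : (Item m k × (Fin m → ℝ)) × S |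
      l = τ.pick t w.2 (bestOptions w.1.1 w.1.2)} := by
    have : {w : (Item m k × (Fin m → ℝ)) × S | l = τ.pick t w.2 (bestOptions w.1.1 w.1.2)} =
        ⋃ A, (Prod.fst ⁻¹' {w | bestOptions w.1 w.2 = A}) ∩
          (Prod.snd ⁻¹' ((fun s => τ.pick t s A) ⁻¹' {l})) := by
      ext w
      simp [eq_comm]
    rw [this]
    exact MeasurableSet.iUnion fun A => (measurable_fst (measurableSet_bestOptions_eq A)).inter
      (measurable_snd (τ.measurable_pick t A (measurableSet_singleton l)))
  have heq : (fun w : (Item m k × (Fin m → ℝ)) × S => decision τ w.2 t w.1.1 w.1.2 l) =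
      fun w => open Classical in if 0 < maxProfit w.1.1 w.1.2 then
        (if l = τ.pick t w.2 (bestOptions w.1.1 w.1.2) then (1 : ℝ) else 0) else 0 := by
    ext w
    unfold decision
    split_ifs <;> simp_all
  rw [heq]
  classical
  exact Measurable.ite
    (measurableSet_lt measurable_const (measurable_maxProfit.comp measurable_fst))
    (Measurable.ite hset measurable_const measurable_const) measurable_const

lemma measurable_price (τ : Picker n k S) (d : Fin m → ℝ) (t : ℕ) :
    Measurable fun w : (Fin n → Item m k) × S => price τ w.2 d w.1 t := by
  induction t with
  | zero => exact measurable_const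
  | succ t ih =>
    by_cases h : t < n
    · simp only [price, dif_pos h]
      refine measurable_pi_lambda _ fun i => ?_
      have hdec : ∀ l, Measurable fun w : (Fin n → Item m k) × S =>
          decision τ w.2 ⟨t, h⟩ (w.1 ⟨t, h⟩) (price τ w.2 d w.1 t) l := fun l =>
        (measurable_decision τ ⟨t, h⟩ l).comp
          ((((measurable_pi_apply _).comp measurable_fst).prodMk ih).prodMk measurable_snd)
      fun_prop
    · simpa only [price, dif_neg h] using ih

lemma measurable_output (τ : Picker n k S) (d : Fin m → ℝ) (t : Fin n) (l : Fin k) :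
    Measurable fun w : (Fin n → Item m k) × S => output τ w.2 d w.1 t l :=
  (measurable_decision τ t l).comp ((((measurable_pi_apply t).comp measurable_fst).prodMk
    (measurable_price τ d t)).prodMk measurable_snd)

lemma measurable_reward (τ : Picker n k S) (d : Fin m → ℝ) :
    Measurable fun w : (Fin n → Item m k) × S => reward τ w.2 d w.1 := by
  unfold reward objective
  have := measurable_output (m := m) τ d
  fun_prop

lemma measurable_violation (τ : Picker n k S) (d : Fin m → ℝ) :
    Measurable fun w : (Fin n → Item m k) × S => violation τ w.2 d w.1 := by
  have := measurable_output (m := m) τ d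
  simp only [violation, EuclideanSpace.norm_eq, consumption]
  fun_prop

lemma isCompact_simplexProduct :
    IsCompact {x : Fin n → Fin k → ℝ | (∀ j, ∑ l, x j l ≤ 1) ∧ ∀ j l, 0 ≤ x j l} := by
  refine (isCompact_Icc (a := (0 : Fin n → Fin k → ℝ)) (b := 1)).of_isClosed_subset ?_ ?_
  · simp only [Set.ofPred_and, Set.ofPred_forall]
    refine (isClosed_iInter fun j => isClosed_le (by fun_prop) continuous_const).inter
      (isClosed_iInter fun j => isClosed_iInter fun l => isClosed_le continuous_const (by fun_prop))
  · rintro x ⟨h1, h0⟩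
    exact ⟨fun j l => h0 j l, fun j l =>
      (Finset.single_le_sum (fun l _ => h0 j l) (Finset.mem_univ l)).trans (h1 j)⟩

lemma continuous_objective :
    Continuous fun w : (Fin n → Item m k) × (Fin n → Fin k → ℝ) => objective w.1 w.2 := by
  unfold objective
  fun_prop

lemma continuous_consumption (i : Fin m) :
    Continuous fun w : (Fin n → Item m k) × (Fin n → Fin k → ℝ) => consumption w.1 w.2 i := by
  unfold consumption
  fun_prop

lemma isClosed_setOf_mem_feasibleSet (d : Fin m → ℝ) :
    IsClosed {w : (Fin n → Item m k) × (Fin n → Fin k → ℝ) | w.2 ∈ feasibleSet d w.1} := by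
  have h : {w : (Fin n → Item m k) × (Fin n → Fin k → ℝ) | w.2 ∈ feasibleSet d w.1} =
      (⋂ i, {w | consumption w.1 w.2 i ≤ n * d i}) ∩ Prod.snd ⁻¹'
        {x : Fin n → Fin k → ℝ | (∀ j, ∑ l, x j l ≤ 1) ∧ ∀ j l, 0 ≤ x j l} := by
    ext w
    simp [feasibleSet]
  rw [h]
  exact (isClosed_iInter fun i => isClosed_le (continuous_consumption i) continuous_const).inter
    (isCompact_simplexProduct.isClosed.preimage continuous_snd)

lemma isCompact_feasibleSet (d : Fin m → ℝ) (z : Fin n → Item m k) :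
    IsCompact (feasibleSet d z) :=
  isCompact_simplexProduct.of_isClosed_subset
    ((isClosed_setOf_mem_feasibleSet d).preimage (Continuous.prodMk_right z)) fun _ hx => hx.2

/-- The optimal value is upper semicontinuous in the data, hence measurable. -/
lemma measurable_lpValue {d : Fin m → ℝ} (hd : ∀ i, 0 ≤ d i) :
    Measurable fun z : Fin n → Item m k => lpValue d z := by
  refine measurable_of_Ici fun c => IsClosed.measurableSet ?_
  have : CompactSpace
      {x : Fin n → Fin k → ℝ // (∀ j, ∑ l, x j l ≤ 1) ∧ ∀ j l, 0 ≤ x j l} :=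
    isCompact_iff_compactSpace.1 isCompact_simplexProduct
  -- A superlevel set is the projection, along a compact factor, of the closed set of pairs of data
  -- and feasible points with objective at least `c`; attainment of the supremum gives one
  -- inclusion. Such a projection is a closed map.
  have h : (fun z : Fin n → Item m k => lpValue d z) ⁻¹' Set.Ici c =
      Prod.fst '' {w : (Fin n → Item m k) ×
        {x : Fin n → Fin k → ℝ // (∀ j, ∑ l, x j l ≤ 1) ∧ ∀ j l, 0 ≤ x j l} |
          w.2.1 ∈ feasibleSet d w.1 ∧ c ≤ objective w.1 w.2.1} := by
    ext z
    constructor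
    · intro hz
      have hcont : ContinuousOn (objective z) (feasibleSet d z) :=
        (continuous_objective.comp (Continuous.prodMk_right z)).continuousOn
      have hmem := ((isCompact_feasibleSet d z).image_of_continuousOn hcont).sSup_mem
        ⟨_, 0, zero_mem_feasibleSet hd z, rfl⟩
      obtain ⟨x, hx, hxv⟩ := hmem
      refine ⟨(z, ⟨x, hx.2⟩), ⟨hx, ?_⟩, rfl⟩
      have : c ≤ lpValue d z := hz
      rwa [lpValue, ← hxv] at this
    · rintro ⟨⟨z', x⟩, ⟨hx, hc⟩, rfl⟩
      have hbdd : BddAbove (objective z' '' feasibleSet d z') := by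
        refine ⟨∑ j, (∑ i, d i * 0 + surplus (z' j) 0), ?_⟩
        rintro _ ⟨x, hx, rfl⟩
        exact objective_le_dual hx le_rfl
      exact le_trans hc (le_csSup hbdd ⟨x, hx, rfl⟩)
  rw [h]
  refine isClosedMap_fst_of_compactSpace _ ?_
  have hcont : Continuous fun w : (Fin n → Item m k) ×
      {x : Fin n → Fin k → ℝ // (∀ j, ∑ l, x j l ≤ 1) ∧ ∀ j l, 0 ≤ x j l} => (w.1, w.2.1) := by
    fun_prop
  exact ((isClosed_setOf_mem_feasibleSet d).preimage hcont).inter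
    (isClosed_le continuous_const (continuous_objective.comp hcont))

end Measurability

/-! ### Integrating out the independent seed -/

section Seeds

/-- Reduction of an expectation over independent data and seed to expectations over the data. -/
lemma integrable_and_integral_le {Ω α S : Type*} [MeasurableSpace Ω] [MeasurableSpace α]
    [MeasurableSpace S] {μ : Measure Ω} [IsProbabilityMeasure μ] {X : Ω → α} {ξ : Ω → S}
    (hX : AEMeasurable X μ) (hξ : Measurable ξ) (hind : IndepFun X ξ μ) {F : α → S → ℝ}
    (hF : Measurable fun w : α × S => F w.1 w.2) {M : ℝ}
    (hM : ∀ᵐ z ∂μ.map X, ∀ s, |F z s| ≤ M) {B : ℝ} (hB : ∀ s, ∫ z, F z s ∂μ.map X ≤ B) :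
    Integrable (fun ω => F (X ω) (ξ ω)) μ ∧ ∫ ω, F (X ω) (ξ ω) ∂μ ≤ B := by
  have := Measure.isProbabilityMeasure_map hX
  have := Measure.isProbabilityMeasure_map (μ := μ) hξ.aemeasurable
  have hpair : AEMeasurable (fun ω => (X ω, ξ ω)) μ := hX.prodMk hξ.aemeasurable
  have hlaw : μ.map (fun ω => (X ω, ξ ω)) = (μ.map X).prod (μ.map ξ) :=
    (indepFun_iff_map_prod_eq_prod_map_map hX hξ.aemeasurable).1 hind
  have hint : Integrable (fun w : α × S => F w.1 w.2) ((μ.map X).prod (μ.map ξ)) := by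
    refine Integrable.of_bound hF.aestronglyMeasurable M ?_
    filter_upwards [Measure.quasiMeasurePreserving_fst.ae hM] with w hw
    exact hw w.2
  have hint' := hint
  rw [← hlaw] at hint'
  refine ⟨(integrable_map_measure hF.aestronglyMeasurable hpair).1 hint', ?_⟩
  have h1 : ∫ ω, F (X ω) (ξ ω) ∂μ = ∫ w, F w.1 w.2 ∂((μ.map X).prod (μ.map ξ)) := by
    rw [← hlaw, integral_map hpair hF.aestronglyMeasurable]
  -- The data are integrated first with the seed frozen, which is the order in which `hB` applies.
  rw [h1, integral_prod_symm _ hint]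
  calc ∫ s, ∫ z, F z s ∂μ.map X ∂μ.map ξ ≤ ∫ _s, B ∂μ.map ξ :=
        integral_mono hint.integral_prod_right (integrable_const B) hB
    _ = B := by simp

/-- Nonnegativity makes measurability of `f` unnecessary. -/
lemma integral_le_of_ae_le {α : Type*} [MeasurableSpace α] {μ : Measure α}
    [IsProbabilityMeasure μ] {f : α → ℝ} (h0 : ∀ z, 0 ≤ f z) {c : ℝ} (hc : ∀ᵐ z ∂μ, f z ≤ c) :
    ∫ z, f z ∂μ ≤ c :=
  (integral_mono_of_nonneg (Filter.Eventually.of_forall h0) (integrable_const c) hc).trans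
    (by simp)

end Seeds

/-! ### A priori bounds, for integrability -/

section Bounds

variable {m k n : ℕ} {S : Type*} [MeasurableSpace S]

lemma surplus_le {rbar abar : ℝ} (hk : 0 < k) (hr : 0 ≤ rbar) (ha : 0 ≤ abar) {z : Item m k}
    (hz : IsBounded rbar abar z) {p : Fin m → ℝ} (hp : ∀ i, 0 ≤ p i) :
    surplus z p ≤ rbar + abar * ∑ i, p i := by
  have : Nonempty (Fin k) := ⟨⟨0, hk⟩⟩
  have h0 : 0 ≤ ∑ i, p i := Finset.sum_nonneg fun i _ => hp i
  refine max_le (ciSup_le fun l => ?_) (by positivity)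
  have h1 : -∑ i, z.2 i l * p i ≤ abar * ∑ i, p i := by
    rw [Finset.mul_sum, ← Finset.sum_neg_distrib]
    refine Finset.sum_le_sum fun i _ => ?_
    rw [← neg_mul]
    exact mul_le_mul_of_nonneg_right ((neg_le_abs _).trans (hz.2 i l)) (hp i)
  have h2 := (le_abs_self _).trans (hz.1 l)
  unfold profit
  linarith

lemma abs_reward_le {rbar abar : ℝ} (hr : 0 ≤ rbar) {z : Fin n → Item m k}
    (hz : ∀ j, IsBounded rbar abar (z j)) (τ : Picker n k S) (s : S) (d : Fin m → ℝ) :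
    |reward τ s d z| ≤ n * rbar := by
  calc |reward τ s d z| ≤ ∑ j, |∑ l, (z j).1 l * output τ s d z j l| := by
        unfold reward objective
        exact Finset.abs_sum_le_sum_abs _ _
    _ ≤ ∑ _j : Fin n, rbar := Finset.sum_le_sum fun j _ =>
        abs_sum_mul_le hr (hz j).1 (sum_decision_le τ s j _ _) (decision_nonneg τ s j _ _)
    _ = _ := by simp

lemma abs_lpValue_le {rbar abar : ℝ} (hk : 0 < k) (hr : 0 ≤ rbar) (ha : 0 ≤ abar)
    {z : Fin n → Item m k} (hz : ∀ j, IsBounded rbar abar (z j)) {d : Fin m → ℝ}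
    (hd : ∀ i, 0 ≤ d i) : |lpValue d z| ≤ n * rbar := by
  rw [abs_of_nonneg (lpValue_nonneg hd z)]
  calc lpValue d z ≤ ∑ j, (∑ i, d i * (0 : Fin m → ℝ) i + surplus (z j) 0) :=
        lpValue_le_dual hd z le_rfl
    _ ≤ ∑ _j : Fin n, rbar := Finset.sum_le_sum fun j _ => by
        simpa using surplus_le hk hr ha (hz j) (p := 0) fun _ => le_rfl
    _ = _ := by simp

/-- Two data sequences are allowed so that the value of the original data can be compared with the
reward on a permuted sequence; invariance of the value under permutations is then not needed. -/
lemma abs_lpValue_sub_reward_le {rbar abar : ℝ} (hk : 0 < k) (hr : 0 ≤ rbar) (ha : 0 ≤ abar)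
    {z z' : Fin n → Item m k} (hz : ∀ j, IsBounded rbar abar (z j))
    (hz' : ∀ j, IsBounded rbar abar (z' j)) {d : Fin m → ℝ}
    (hd : ∀ i, 0 ≤ d i) (τ : Picker n k S) (s : S) :
    |lpValue d z - reward τ s d z'| ≤ 2 * (n * rbar) := by
  have h1 := abs_lpValue_le hk hr ha hz hd
  have h2 := abs_reward_le hr hz' τ s d
  calc _ ≤ |lpValue d z| + |reward τ s d z'| := abs_sub _ _
    _ ≤ _ := by linarith

lemma violation_nonneg (τ : Picker n k S) (s : S) (d : Fin m → ℝ) (z : Fin n → Item m k) :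
    0 ≤ violation τ s d z := norm_nonneg _

lemma abs_violation_le {rbar abar dlow dbar : ℝ} (hdlow : 0 < dlow) (hm : 0 < m)
    (hn : 0 < n) (hk : 0 < k) {d : Fin m → ℝ} (hd : ∀ i, dlow ≤ d i ∧ d i ≤ dbar)
    {z : Fin n → Item m k} (hz : ∀ j, IsBounded rbar abar (z j)) (τ : Picker n k S) (s : S) :
    |violation τ s d z| ≤
      ((2 * rbar + m * (abar + dbar) ^ 2) / dlow + m * (abar + dbar)) * √(n : ℝ) := by
  rw [abs_of_nonneg (violation_nonneg τ s d z)]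
  exact violation_le hdlow hm hn hk hd hz τ s

end Bounds

/-! ### Regret in the stochastic input model -/

section Stochastic

variable {m k n : ℕ} {S : Type*} [MeasurableSpace S]

/-- Resampling one coordinate of an i.i.d. sequence preserves its law. -/
lemma map_update_pi {α : Type*} [MeasurableSpace α] (P : Measure α) [IsProbabilityMeasure P]
    (t : Fin n) :
    ((Measure.pi fun _ : Fin n => P).prod P).map (fun w => Function.update w.1 t w.2) =
      Measure.pi fun _ : Fin n => P := by
  have hmeas : Measurable fun w : (Fin n → α) × α => Function.update w.1 t w.2 := by
    refine measurable_pi_lambda _ fun j => ?_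
    by_cases h : j = t
    · subst h; simpa using measurable_snd
    · simp only [Function.update_of_ne h]; fun_prop
  symm
  refine Measure.pi_eq fun A hA => ?_
  rw [Measure.map_apply hmeas (MeasurableSet.univ_pi hA)]
  have hpre : (fun w : (Fin n → α) × α => Function.update w.1 t w.2) ⁻¹' Set.univ.pi A =
      (Set.univ.pi (Function.update A t Set.univ)) ×ˢ A t := by
    ext w
    simp only [Set.mem_preimage, Set.mem_univ_pi, Set.mem_prod]
    constructor
    · refine fun h => ⟨fun j => ?_, by simpa using h t⟩
      by_cases hj : j = t
      · subst hj; simp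
      · simpa [hj] using h j
    · rintro ⟨h, ht⟩ j
      by_cases hj : j = t
      · subst hj; simpa using ht
      · simpa [hj] using h j
  rw [hpre, Measure.prod_prod, Measure.pi_pi, ← Finset.mul_prod_erase _ _ (Finset.mem_univ t),
    ← Finset.mul_prod_erase _ (fun i => P (A i)) (Finset.mem_univ t)]
  simp only [Function.update_self, measure_univ, one_mul]
  rw [mul_comm]
  congr 1
  refine Finset.prod_congr rfl fun j hj => ?_
  rw [Function.update_of_ne (Finset.ne_of_mem_erase hj)]

lemma ae_pi_isBounded {rbar abar : ℝ} {P : Measure (Item m k)} [IsProbabilityMeasure P]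
    (hP : ∀ᵐ z ∂P, IsBounded rbar abar z) :
    ∀ᵐ z ∂(Measure.pi fun _ : Fin n => P), ∀ j, IsBounded rbar abar (z j) :=
  ae_all_iff.2 fun j => (Measure.quasiMeasurePreserving_eval (fun _ : Fin n => P) j).ae hP

/-- The expected optimal value is at most `n` times the dual function at any price. -/
lemma integral_lpValue_le {rbar abar : ℝ} (hk : 0 < k) (hr : 0 ≤ rbar) (ha : 0 ≤ abar)
    {d : Fin m → ℝ} (hd : ∀ i, 0 ≤ d i) {P : Measure (Item m k)} [IsProbabilityMeasure P]
    (hP : ∀ᵐ z ∂P, IsBounded rbar abar z) {q : Fin m → ℝ} (hq : 0 ≤ q) :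
    ∫ z, lpValue d z ∂(Measure.pi fun _ : Fin n => P) ≤
      n * ∫ y, (∑ i, d i * q i + surplus y q) ∂P := by
  have hsurp : Measurable fun y : Item m k => ∑ i, d i * q i + surplus y q :=
    measurable_const.add (measurable_surplus.comp measurable_prodMk_right)
  have hint : Integrable (fun y : Item m k => ∑ i, d i * q i + surplus y q) P := by
    refine Integrable.of_bound hsurp.aestronglyMeasurable
      (∑ i, d i * q i + (rbar + abar * ∑ i, q i)) ?_
    filter_upwards [hP] with y hy
    have h0 : 0 ≤ ∑ i, d i * q i := Finset.sum_nonneg fun i _ => mul_nonneg (hd i) (hq i)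
    rw [Real.norm_eq_abs, abs_of_nonneg (add_nonneg h0 (surplus_nonneg y q))]
    linarith [surplus_le hk hr ha hy hq]
  have hj : ∀ j, Integrable (fun z : Fin n → Item m k => ∑ i, d i * q i + surplus (z j) q)
      (Measure.pi fun _ : Fin n => P) := fun j =>
    (measurePreserving_eval (fun _ : Fin n => P) j).integrable_comp_of_integrable hint
  have hlp : Integrable (fun z : Fin n → Item m k => lpValue d z)
      (Measure.pi fun _ : Fin n => P) := by
    refine Integrable.of_bound (measurable_lpValue hd).aestronglyMeasurable (n * rbar) ?_
    filter_upwards [ae_pi_isBounded hP] with z hz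
    exact abs_lpValue_le hk hr ha hz hd
  calc ∫ z, lpValue d z ∂(Measure.pi fun _ : Fin n => P)
      ≤ ∫ z, ∑ j, (∑ i, d i * q i + surplus (z j) q) ∂(Measure.pi fun _ : Fin n => P) :=
        integral_mono hlp (integrable_finsetSum _ fun j _ => hj j)
          fun z => lpValue_le_dual hd z hq
    _ = ∑ j : Fin n, ∫ y, (∑ i, d i * q i + surplus y q) ∂P := by
        rw [integral_finsetSum _ fun j _ => hj j]
        refine Finset.sum_congr rfl fun j _ => ?_
        have h := integral_map (μ := Measure.pi fun _ : Fin n => P)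
          (measurable_pi_apply j).aemeasurable hsurp.aestronglyMeasurable
        rw [← h]
        congr 1
        exact (measurePreserving_eval (fun _ : Fin n => P) j).map_eq
    _ = _ := by simp

/-- A bound on the one-period dual values along the run of the algorithm. -/
lemma abs_dual_price_le {rbar abar dlow dbar : ℝ} (hdlow : 0 < dlow) (hm : 0 < m)
    (hk : 0 < k) {d : Fin m → ℝ} (hd : ∀ i, dlow ≤ d i ∧ d i ≤ dbar)
    {z : Fin n → Item m k} (hz : ∀ j, IsBounded rbar abar (z j)) (τ : Picker n k S) (s : S)
    (t : Fin n) :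
    |∑ i, d i * price τ s d z t i + surplus (z t) (price τ s d z t)| ≤
      rbar + (abar + dbar) * (m * ((2 * rbar + m * (abar + dbar) ^ 2) / dlow +
        m * (abar + dbar))) := by
  have hr := rbar_nonneg hk (hz t)
  have ha := abar_nonneg hm hk (hz t)
  have hdb : 0 < dbar := hdlow.trans_le ((hd ⟨0, hm⟩).1.trans (hd ⟨0, hm⟩).2)
  set B := (2 * rbar + m * (abar + dbar) ^ 2) / dlow + m * (abar + dbar)
  have hB : 0 ≤ B := by positivity
  have hp := price_nonneg τ s d z t
  have hpi : ∀ i, price τ s d z t i ≤ B := fun i => by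
    refine le_of_sq_le_sq ?_ hB
    exact (Finset.single_le_sum (f := fun i => price τ s d z t i ^ 2)
      (fun i _ => sq_nonneg _) (Finset.mem_univ i)).trans
      (sum_sq_price_le hdlow hm hk hd hz τ s t t.2.le)
  have hsum : ∑ i, price τ s d z t i ≤ m * B :=
    (Finset.sum_le_sum fun i _ => hpi i).trans (by simp)
  have hdp : ∑ i, d i * price τ s d z t i ≤ dbar * ∑ i, price τ s d z t i := by
    rw [Finset.mul_sum]
    exact Finset.sum_le_sum fun i _ => mul_le_mul_of_nonneg_right (hd i).2 (hp i)
  have h0 : 0 ≤ ∑ i, d i * price τ s d z t i :=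
    Finset.sum_nonneg fun i _ => mul_nonneg (hdlow.le.trans (hd i).1) (hp i)
  rw [abs_of_nonneg (add_nonneg h0 (surplus_nonneg _ _))]
  have h1 := surplus_le hk hr ha (hz t) hp
  have h2 := mul_le_mul_of_nonneg_left hsum (add_pos_of_nonneg_of_pos ha hdb).le
  linarith

lemma measurable_dual_price (τ : Picker n k S) (s : S) (d : Fin m → ℝ) (t : Fin n) :
    Measurable fun z : Fin n → Item m k =>
      ∑ i, d i * price τ s d z t i + surplus (z t) (price τ s d z t) := by
  have hp : Measurable fun z : Fin n → Item m k => price τ s d z t :=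
    (measurable_price τ d t).comp (measurable_id.prodMk measurable_const)
  have hs : Measurable fun z : Fin n → Item m k => surplus (z t) (price τ s d z t) :=
    measurable_surplus.comp ((measurable_pi_apply t).prodMk hp)
  fun_prop

/-- At each step the expected dual value is at least the average expected optimal value. -/
lemma integral_lpValue_div_le {rbar abar dlow dbar : ℝ} (hdlow : 0 < dlow) (hm : 0 < m)
    (hk : 0 < k) (hr : 0 ≤ rbar) (ha : 0 ≤ abar) {d : Fin m → ℝ}
    (hd : ∀ i, dlow ≤ d i ∧ d i ≤ dbar) {P : Measure (Item m k)} [IsProbabilityMeasure P]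
    (hP : ∀ᵐ z ∂P, IsBounded rbar abar z) (τ : Picker n k S) (s : S) (t : Fin n) :
    Integrable (fun z : Fin n → Item m k => ∑ i, d i * price τ s d z t i +
        surplus (z t) (price τ s d z t)) (Measure.pi fun _ : Fin n => P) ∧
      (∫ z, lpValue d z ∂(Measure.pi fun _ : Fin n => P)) / n ≤
        ∫ z, (∑ i, d i * price τ s d z t i + surplus (z t) (price τ s d z t))
          ∂(Measure.pi fun _ : Fin n => P) := by
  have hn : (0 : ℝ) < n := by exact_mod_cast t.pos
  have hmeas := measurable_dual_price τ s d t
  have hint : Integrable (fun z : Fin n → Item m k => ∑ i, d i * price τ s d z t i +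
        surplus (z t) (price τ s d z t)) (Measure.pi fun _ : Fin n => P) := by
    refine Integrable.of_bound hmeas.aestronglyMeasurable
      (rbar + (abar + dbar) * (m * ((2 * rbar + m * (abar + dbar) ^ 2) / dlow +
        m * (abar + dbar)))) ?_
    filter_upwards [ae_pi_isBounded hP] with z hz
    exact abs_dual_price_le hdlow hm hk hd hz τ s t
  refine ⟨hint, ?_⟩
  have hupd : Measurable fun w : (Fin n → Item m k) × Item m k => Function.update w.1 t w.2 := by
    refine measurable_pi_lambda _ fun j => ?_
    by_cases h : j = t
    · subst h; simpa using measurable_snd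
    · simp only [Function.update_of_ne h]; fun_prop
  -- The price at `t` does not see coordinate `t`, so resampling that coordinate turns the dual
  -- value into a function of the past and a fresh independent draw `y`.
  have hsplit : ∀ (z : Fin n → Item m k) (y : Item m k),
      ∑ i, d i * price τ s d (Function.update z t y) t i +
          surplus (Function.update z t y t) (price τ s d (Function.update z t y) t) =
        ∑ i, d i * price τ s d z t i + surplus y (price τ s d z t) := by
    intro z y
    have : price τ s d (Function.update z t y) t = price τ s d z t :=
      price_congr τ s d fun j hj => Function.update_of_ne (Fin.ne_of_lt hj) _ _
    rw [this, Function.update_self]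
  have hintp : Integrable (fun w : (Fin n → Item m k) × Item m k =>
      ∑ i, d i * price τ s d w.1 t i + surplus w.2 (price τ s d w.1 t))
      ((Measure.pi fun _ : Fin n => P).prod P) := by
    have h := hint
    rw [← map_update_pi P t, integrable_map_measure hmeas.aestronglyMeasurable
      hupd.aemeasurable] at h
    exact h.congr (Filter.Eventually.of_forall fun w => hsplit w.1 w.2)
  rw [← map_update_pi P t, integral_map hupd.aemeasurable hmeas.aestronglyMeasurable]
  simp only [hsplit]
  -- After Fubini the inner integral over `y` is the population dual function at the frozen price
  -- `price τ s d z t`, to which weak duality applies for every `z`.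
  rw [integral_prod _ hintp, map_update_pi P t]
  calc (∫ z, lpValue d z ∂(Measure.pi fun _ : Fin n => P)) / n
      = ∫ _z : Fin n → Item m k, (∫ z, lpValue d z ∂(Measure.pi fun _ : Fin n => P)) / n
          ∂(Measure.pi fun _ : Fin n => P) := by simp
    _ ≤ _ := by
        refine integral_mono (integrable_const _) hintp.integral_prod_left fun z => ?_
        simp only
        rw [div_le_iff₀' hn]
        exact integral_lpValue_le hk hr ha (fun i => hdlow.le.trans (hd i).1) hP
          fun i => price_nonneg τ s d z t i

/-- The regret bound in the stochastic input model, for a fixed seed. -/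
lemma integral_regret_le {rbar abar dlow dbar : ℝ} (hdlow : 0 < dlow) (hm : 0 < m) (hn : 0 < n)
    (hk : 0 < k) (hr : 0 ≤ rbar) (ha : 0 ≤ abar) {d : Fin m → ℝ}
    (hd : ∀ i, dlow ≤ d i ∧ d i ≤ dbar) {P : Measure (Item m k)} [IsProbabilityMeasure P]
    (hP : ∀ᵐ z ∂P, IsBounded rbar abar z) (τ : Picker n k S) (s : S) :
    ∫ z, (lpValue d z - reward τ s d z) ∂(Measure.pi fun _ : Fin n => P) ≤
      m * (abar + dbar) ^ 2 / 2 * √(n : ℝ) := by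
  have hn' : (n : ℝ) ≠ 0 := by positivity
  have hd0 : ∀ i, 0 ≤ d i := fun i => hdlow.le.trans (hd i).1
  have hdual := integral_lpValue_div_le hdlow hm hk hr ha hd hP τ s
  have hlp : Integrable (fun z : Fin n → Item m k => lpValue d z)
      (Measure.pi fun _ : Fin n => P) := by
    refine Integrable.of_bound (measurable_lpValue hd0).aestronglyMeasurable (n * rbar) ?_
    filter_upwards [ae_pi_isBounded hP] with z hz
    exact abs_lpValue_le hk hr ha hz hd0
  have hrew : Integrable (fun z : Fin n → Item m k => reward τ s d z)
      (Measure.pi fun _ : Fin n => P) := by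
    refine Integrable.of_bound ((measurable_reward τ d).comp
      (measurable_id.prodMk measurable_const)).aestronglyMeasurable (n * rbar) ?_
    filter_upwards [ae_pi_isBounded hP] with z hz
    exact abs_reward_le hr hz τ s d
  have hsum : Integrable (fun z : Fin n → Item m k => ∑ t : Fin n,
      (∑ i, d i * price τ s d z t i + surplus (z t) (price τ s d z t)))
      (Measure.pi fun _ : Fin n => P) := integrable_finsetSum _ fun t _ => (hdual t).1
  have h1 : ∫ z, (∑ t : Fin n, (∑ i, d i * price τ s d z t i +
      surplus (z t) (price τ s d z t)) - m * (abar + dbar) ^ 2 / 2 * √(n : ℝ))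
      ∂(Measure.pi fun _ : Fin n => P) ≤
      ∫ z, reward τ s d z ∂(Measure.pi fun _ : Fin n => P) := by
    refine integral_mono_ae (hsum.sub (integrable_const _)) hrew ?_
    filter_upwards [ae_pi_isBounded hP] with z hz
    exact sum_dual_sub_le_reward hdlow hm hn hk hd hz τ s
  rw [integral_sub hsum (integrable_const _), integral_finsetSum _ fun t _ => (hdual t).1] at h1
  have h2 := Finset.sum_le_sum fun t (_ : t ∈ Finset.univ) => (hdual t).2
  simp only [Finset.sum_const, Finset.card_univ, Fintype.card_fin, nsmul_eq_mul] at h2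
  rw [mul_div_cancel₀ _ hn'] at h2
  rw [integral_sub hlp hrew]
  simp only [integral_const, probReal_univ, smul_eq_mul, one_mul] at h1
  linarith

end Stochastic

end MultiILP

/-! ### The main theorem -/

open MultiILP in
theorem theorem3 (rbar abar dlow dbar : ℝ) (hdlow : 0 < dlow) :
    -- stochastic input model
    (∀ (m n k : ℕ), 0 < m → 0 < n → 0 < k →
      ∀ d : Fin m → ℝ, (∀ i, dlow ≤ d i ∧ d i ≤ dbar) →
      ∀ P : Measure (Item m k), IsProbabilityMeasure P → (∀ᵐ z ∂P, IsBounded rbar abar z) →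
      ∀ (Ω : Type*) [MeasurableSpace Ω] (μ : Measure Ω) [IsProbabilityMeasure μ]
        (S : Type*) [MeasurableSpace S]
        (Z : Fin n → Ω → Item m k) (ξ : Ω → S) (τ : Picker n k S),
        (∀ j, HasLaw (Z j) P μ) → iIndepFun Z μ →
        Measurable ξ → IndepFun (fun ω j => Z j ω) ξ μ →
        Integrable (fun ω => lpValue d (fun j => Z j ω) - reward τ (ξ ω) d (fun j => Z j ω)) μ ∧
        ∫ ω, (lpValue d (fun j => Z j ω) - reward τ (ξ ω) d (fun j => Z j ω)) ∂μ
          ≤ m * (abar + dbar) ^ 2 * √(n : ℝ) ∧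
        Integrable (fun ω => violation τ (ξ ω) d (fun j => Z j ω)) μ ∧
        ∫ ω, violation τ (ξ ω) d (fun j => Z j ω) ∂μ
          ≤ ((2 * rbar + m * (abar + dbar) ^ 2) / dlow + m * (abar + dbar)) * √(n : ℝ)) ∧
    -- random permutation model
    (∃ C : ℝ, ∀ (m n k : ℕ), 0 < m → 0 < n → 0 < k →
      ∀ d : Fin m → ℝ, (∀ i, dlow ≤ d i ∧ d i ≤ dbar) →
      ∀ z : Fin n → Item m k, (∀ j, IsBounded rbar abar (z j)) → GeneralPosition d z →
      ∀ (Ω : Type*) [MeasurableSpace Ω] (μ : Measure Ω) [IsProbabilityMeasure μ]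
        (S : Type*) [MeasurableSpace S]
        (σ : Ω → Equiv.Perm (Fin n)) (ξ : Ω → S) (τ : Picker n k S),
        HasLaw σ (PMF.uniformOfFintype (Equiv.Perm (Fin n))).toMeasure μ →
        Measurable ξ → IndepFun σ ξ μ →
        Integrable (fun ω => reward τ (ξ ω) d (fun j => z (σ ω j))) μ ∧
        lpValue d z - ∫ ω, reward τ (ξ ω) d (fun j => z (σ ω j)) ∂μ
          ≤ C * ((m + Real.log n) * √(n : ℝ)) ∧
        Integrable (fun ω => violation τ (ξ ω) d (fun j => z (σ ω j))) μ ∧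
        ∫ ω, violation τ (ξ ω) d (fun j => z (σ ω j)) ∂μ ≤ C * (m * √(n : ℝ))) := by
  refine ⟨?_, ?_⟩
  · intro m n k hm hn hk d hd P _ hP Ω _ μ _ S _ Z ξ τ hZ hindep hξ hind
    obtain ⟨z₀, hz₀⟩ := hP.exists
    have hr := rbar_nonneg hk hz₀
    have ha := abar_nonneg hm hk hz₀
    have hd0 : ∀ i, 0 ≤ d i := fun i => hdlow.le.trans (hd i).1
    have hZm : AEMeasurable (fun ω j => Z j ω) μ :=
      aemeasurable_pi_lambda _ fun j => (hZ j).aemeasurable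
    have hlaw : μ.map (fun ω j => Z j ω) = Measure.pi fun _ : Fin n => P := by
      rw [(iIndepFun_iff_map_fun_eq_pi_map fun j => (hZ j).aemeasurable).1 hindep]
      congr 1
      exact funext fun j => (hZ j).map_eq
    have hbdd := ae_pi_isBounded (n := n) hP
    have hreg := integrable_and_integral_le hZm hξ hind
      (F := fun z s => lpValue d z - reward τ s d z)
      (((measurable_lpValue hd0).comp measurable_fst).sub (measurable_reward τ d))
      (M := 2 * (n * rbar))
      (by
        rw [hlaw]
        filter_upwards [hbdd] with z hz s
        exact abs_lpValue_sub_reward_le hk hr ha hz hz hd0 τ s)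
      (B := m * (abar + dbar) ^ 2 / 2 * √(n : ℝ))
      (fun s => by rw [hlaw]; exact integral_regret_le hdlow hm hn hk hr ha hd hP τ s)
    have hvio := integrable_and_integral_le hZm hξ hind
      (F := fun z s => violation τ s d z) (measurable_violation τ d)
      (M := ((2 * rbar + m * (abar + dbar) ^ 2) / dlow + m * (abar + dbar)) * √(n : ℝ))
      (by
        rw [hlaw]
        filter_upwards [hbdd] with z hz s
        exact abs_violation_le hdlow hm hn hk hd hz τ s)
      (B := ((2 * rbar + m * (abar + dbar) ^ 2) / dlow + m * (abar + dbar)) * √(n : ℝ))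
      (fun s => by
        rw [hlaw]
        refine integral_le_of_ae_le (violation_nonneg τ s d) ?_
        filter_upwards [hbdd] with z hz
        exact violation_le hdlow hm hn hk hd hz τ s)
    refine ⟨hreg.1, hreg.2.trans ?_, hvio.1, hvio.2⟩
    -- The argument gives half of the stated regret constant; nonnegativity of the other half closes
    -- the gap.
    have : 0 ≤ m * (abar + dbar) ^ 2 / 2 * √(n : ℝ) := by positivity
    linarith
  · refine ⟨rbar / dlow * (4 * abar ^ 2 + 1) + (abar + dbar) ^ 2 / 2 +
      ((2 * rbar + (abar + dbar) ^ 2) / dlow + (abar + dbar)), ?_⟩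
    intro m n k hm hn hk d hd z hz _ Ω _ μ _ S _ σ ξ τ hσ hξ hind
    have hr := rbar_nonneg hk (hz ⟨0, hn⟩)
    have ha := abar_nonneg hm hk (hz ⟨0, hn⟩)
    have hd0 : ∀ i, 0 ≤ d i := fun i => hdlow.le.trans (hd i).1
    have hdb : 0 < dbar := hdlow.trans_le ((hd ⟨0, hm⟩).1.trans (hd ⟨0, hm⟩).2)
    have hm1 : (1 : ℝ) ≤ m := by exact_mod_cast hm
    have hlog : 0 ≤ Real.log n := Real.log_natCast_nonneg n
    -- The permutations form a countable discrete space, so joint measurability reduces to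
    -- measurability in the seed for each permutation.
    have hperm : ∀ {f : (Fin n → Item m k) × S → ℝ}, Measurable f →
        Measurable fun w : Equiv.Perm (Fin n) × S => f (fun j => z (w.1 j), w.2) := fun hf =>
      measurable_from_prod_countable_right fun π =>
        hf.comp (measurable_prodMk_left (x := fun j => z (π j)))
    have hreg := integrable_and_integral_le hσ.aemeasurable hξ hind
      (F := fun π s => lpValue d z - reward τ s d (fun j => z (π j)))
      (measurable_const.sub (hperm (measurable_reward τ d)))
      (M := 2 * (n * rbar))
      (Filter.Eventually.of_forall fun π s =>
        abs_lpValue_sub_reward_le hk hr ha hz (fun j => hz (π j)) hd0 τ s)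
      (B := (rbar / dlow * (4 * abar ^ 2 + 1) + (abar + dbar) ^ 2 / 2) * (m * √(n : ℝ)))
      (fun s => by
        rw [hσ.map_eq, PMF.integral_eq_sum]
        have h := lpValue_sub_le_average_reward hdlow hm hn hk hd hz τ s
        have hN : (0 : ℝ) < Fintype.card (Equiv.Perm (Fin n)) := by
          exact_mod_cast Fintype.card_pos
        simp only [PMF.uniformOfFintype_apply, ENNReal.toReal_inv, ENNReal.toReal_natCast,
          smul_eq_mul]
        rw [← Finset.mul_sum, inv_mul_le_iff₀ hN, Finset.sum_sub_distrib]
        simp only [Finset.sum_const, Finset.card_univ, nsmul_eq_mul]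
        linarith)
    have hvb : ((2 * rbar + m * (abar + dbar) ^ 2) / dlow + m * (abar + dbar)) * √(n : ℝ) ≤
        ((2 * rbar + (abar + dbar) ^ 2) / dlow + (abar + dbar)) * (m * √(n : ℝ)) := by
      have h1 : 2 * rbar ≤ 2 * rbar * m := le_mul_of_one_le_right (by positivity) hm1
      calc _ ≤ ((2 * rbar * m + m * (abar + dbar) ^ 2) / dlow + m * (abar + dbar)) *
            √(n : ℝ) := by gcongr
        _ = _ := by ring
    have hviol : ∀ (π : Equiv.Perm (Fin n)) s, violation τ s d (fun j => z (π j)) ≤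
        ((2 * rbar + (abar + dbar) ^ 2) / dlow + (abar + dbar)) * (m * √(n : ℝ)) := fun π s =>
      (violation_le hdlow hm hn hk hd (z := fun j => z (π j)) (fun j => hz (π j)) τ s).trans hvb
    have hviol0 : ∀ (π : Equiv.Perm (Fin n)) s, 0 ≤ violation τ s d (fun j => z (π j)) :=
      fun π s => violation_nonneg τ s d _
    set C₂ := (2 * rbar + (abar + dbar) ^ 2) / dlow + (abar + dbar)
    have hvio := integrable_and_integral_le hσ.aemeasurable hξ hind
      (F := fun π s => violation τ s d (fun j => z (π j))) (hperm (measurable_violation τ d))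
      (M := C₂ * (m * √(n : ℝ)))
      (Filter.Eventually.of_forall fun π s => by
        rw [abs_of_nonneg (hviol0 π s)]
        exact hviol π s)
      (B := C₂ * (m * √(n : ℝ)))
      (fun s => by
        have := Measure.isProbabilityMeasure_map hσ.aemeasurable
        refine integral_le_of_ae_le ?_ (Filter.Eventually.of_forall ?_)
        · intro π
          exact hviol0 π s
        · intro π
          exact hviol π s)
    -- The value is a constant here, so the reward is this constant minus the integrable regret.
    have hint : Integrable (fun ω => reward τ (ξ ω) d (fun j => z (σ ω j))) μ := by
      refine ((integrable_const (lpValue d z)).sub hreg.1).congr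
        (Filter.Eventually.of_forall fun ω => ?_)
      simp
    have hreg2 := hreg.2
    rw [integral_sub (integrable_const _) hint] at hreg2
    simp only [integral_const, probReal_univ, smul_eq_mul, one_mul] at hreg2
    set C₁ := rbar / dlow * (4 * abar ^ 2 + 1) + (abar + dbar) ^ 2 / 2
    have hC₁ : 0 ≤ C₁ := by positivity
    have hC₂ : 0 ≤ C₂ := by positivity
    refine ⟨hint, hreg2.trans ?_, hvio.1, hvio.2.trans ?_⟩
    -- The regret bound already holds with `m √n`; the `log n` term is nonnegative slack.
    · gcongr
      · linarith
      · linarith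
    · gcongr
      linarith
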